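/- Let $\mathbb{R}_{\min}=\mathbb{R}\cup\{+\infty\}$ be the min-plus semiring ($a\oplus b=\min(a,b)$, $a\otimes b=a+b$), let $A$ be an $n\times n$ matrix over $\mathbb{R}_{\min}$, and let $G(A)$ be the graph with nodes $1,\dots,n$ and an arc $(i,j)$ whenever $A_{ij}\neq+\infty$. Assume that $A$ is irreducible, i.e. $G(A)$ is strongly connected, with $A\neq(+\infty)$ if $n=1$. For a circuit $c$, let $|c|$ be its length, $|c|_A$ the sum of the entries of $A$ along its arcs, and $|c|_C$ the number of its arcs whose initial node is in $C$. Let $\rho_{\min}(A)=\min_c |c|_A/|c|$ over the circuits $c$ of $G(A)$; the circuits that attain the minimum are called critical, and so are their nodes. For a real $\lambda\le\rho_{\min}(A_{CC})$ and $N$ the complement of $C$, put $$\mathrm{Schur}(C,\lambda,A)=A_{NN}\oplus A_{NC}\,(\lambda^{-1}A_{CC})^{*}\,\lambda^{-1}A_{CN},\qquad M^*=I\oplus M\oplus M^2\oplus\cdots$$ (min-plus operations, with indices inherited from $A$). Define $A_1=A$ and, for $\ell\ge1$, $\alpha_\ell=\rho_{\min}(A_\ell)$, $C_\ell$ the set of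 critical nodes of $A_\ell$, and $A_{\ell+1}=\mathrm{Schur}(C_\ell,\alpha_\ell,A_\ell)$ as long as $C_1\cup\dots\cup C_\ell\ne\{1,\dots,n\}$. Let $k$ be the first index with $C_1\cup\dots\cup C_k=\{1,\dots,n\}$; $\alpha_1,\dots,\alpha_k$ are the critical values of $A$. For $1\le\ell\le k$, let $G^c_\ell(A)$ be the graph whose nodes and arcs are those of the circuits $c$ of $G(A)$ such that $$|c|_A-\sum_{m<\ell}\alpha_m|c|_{C_m}=\alpha_\ell\Bigl(|c|-\sum_{m<\ell}|c|_{C_m}\Bigr),$$ and let $G^c_0(A)$ be the empty graph. A graph has a disjoint circuit cover if pairwise disjoint elementary circuits of it contain all its nodes (the empty graph has one). The min-plus characteristic polynomial of $A$ is the permanent $\mathrm{per}(\mathsf{Y}I\oplus A)$. The roots of a min-plus polynomial $P$ of degree $d$, with leading coefficient $P_d$, are the elements $c_1\le\dots\le c_d$ of $\mathbb{R}_{\min}$, unique, such that $P(y)=P_d\otimes(y\oplus c_1)\otimes\cdots\otimes(y\oplus c_d)$ for all $y\in\mathbb{R}_{\min}$; the multiplicity of a root is the number of times it occurs among them. Let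 $1\le\ell\le k$. If $G^c_{\ell-1}(A)$ and $G^c_\ell(A)$ both have a disjoint circuit cover, then $\alpha_\ell$ is a root of the min-plus characteristic polynomial of $A$, of multiplicity exactly $|C_\ell|$. -/

import Mathlib

open scoped Polynomial

noncomputable section

namespace MinPlus

/-- The min-plus semiring `ℝ ∪ {+∞}`: its sum is the minimum, its product is the usual addition,
its zero is `+∞` and its unit is the real number `0`. -/
abbrev Rmin : Type := Tropical (WithTop ℝ)

/-- A real number, seen in the min-plus semiring. -/
def ofReal (x : ℝ) : Rmin := Tropical.trop (x : WithTop ℝ)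

/-! ### Directed graphs and circuits -/

/-- A directed graph whose nodes form a subset of `V`. -/
structure Graph (V : Type*) where
  nodes : Set V
  arcs : Set (V × V)

/-- The arcs `(i₁, i₂), …, (i_{k-1}, i_k), (i_k, i₁)` of the closed path through `[i₁, …, i_k]`. -/
def arcsOf {V : Type*} (c : List V) : List (V × V) := c.zip (c.rotate 1)

/-- The list `[i₁, …, i_k]`, with `k ≥ 1`, stands for the circuit `(i₁, …, i_k, i₁)`. Nodes may be
repeated; the length of the circuit is `k`. -/
def Graph.IsCircuit {V : Type*} (G : Graph V) (c : List V) : Prop :=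
  c ≠ [] ∧ (∀ v ∈ c, v ∈ G.nodes) ∧ ∀ a ∈ arcsOf c, a ∈ G.arcs

/-- The graph has finitely many elementary circuits, no two of which share a node, that together
contain all its nodes. (That the concatenation has no duplicates says both that each circuit is
elementary and that distinct circuits are disjoint.) -/
def Graph.HasDisjointCircuitCover {V : Type*} (G : Graph V) : Prop :=
  ∃ cs : List (List V),
    (∀ c ∈ cs, G.IsCircuit c) ∧ cs.flatten.Nodup ∧ ∀ v ∈ G.nodes, v ∈ cs.flatten

/-- The graph formed by the nodes and the arcs of a family of circuits. -/
def graphOfCircuits {V : Type*} (F : Set (List V)) : Graph V where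
  nodes := {v | ∃ c ∈ F, v ∈ c}
  arcs := {a | ∃ c ∈ F, a ∈ arcsOf c}

/-! ### Min-plus matrices -/

section Matrices

variable {L : Type*}

/-- The graph `G(A)`: all indices are nodes, and there is an arc `(i, j)` when `A i j ≠ +∞`. -/
def graphOf (A : Matrix L L Rmin) : Graph L where
  nodes := Set.univ
  arcs := {a | A a.1 a.2 ≠ 0}

/-- `A` is irreducible: any two nodes `i`, `j` are joined by a path of positive length of `G(A)`.
For `i = j` the requirement of a positive length only excludes the `1 × 1` matrix `(+∞)`, whose
graph has no circuit. -/
def IsIrreducible (A : Matrix L L Rmin) : Prop :=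
  ∀ i j : L, Relation.TransGen (fun p q => (p, q) ∈ (graphOf A).arcs) i j

/-- The weight `|c|_A` of a circuit `c` of `G(A)` (on which all the entries are finite). -/
def weight (A : Matrix L L Rmin) (c : List L) : ℝ :=
  ((arcsOf c).map fun a => (Tropical.untrop (A a.1 a.2)).untopD 0).sum

/-- The minimal circuit mean `ρ_min(A)`. -/
def rhoMin (A : Matrix L L Rmin) : ℝ :=
  sInf {x | ∃ c, (graphOf A).IsCircuit c ∧ x = weight A c / c.length}

/-- A circuit of `G(A)` is critical if its mean is the minimal one. -/
def IsCriticalCircuit (A : Matrix L L Rmin) (c : List L) : Prop :=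
  (graphOf A).IsCircuit c ∧ weight A c / c.length = rhoMin A

variable [Fintype L] [DecidableEq L]

open Classical in
/-- The set of the nodes of the critical circuits of `A`. -/
def criticalNodes (A : Matrix L L Rmin) : Finset L :=
  Finset.univ.filter fun v => ∃ c, IsCriticalCircuit A c ∧ v ∈ c

/-- Kleene's star `A* = I ⊕ A ⊕ A² ⊕ ⋯`, entrywise the infimum of the powers of `A`. It is used
only when `ρ_min(A) ≥ 0`, and then no infimum is `-∞`. -/
def kleeneStar (A : Matrix L L Rmin) : Matrix L L Rmin :=
  fun i j => Tropical.trop (⨅ k : ℕ, Tropical.untrop ((A ^ k) i j))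

/-- The min-plus Schur complement
`Schur(C, lam, A) = A_NN ⊕ A_NC (lam⁻¹ A_CC)* lam⁻¹ A_CN`, where `N` is the complement of `C`. -/
def schur (C : Finset L) (lam : ℝ) (A : Matrix L L Rmin) :
    Matrix {i // i ∉ C} {i // i ∉ C} Rmin :=
  A.toBlock (· ∉ C) (· ∉ C) +
    A.toBlock (· ∉ C) (· ∈ C) * kleeneStar (ofReal (-lam) • A.toBlock (· ∈ C) (· ∈ C)) *
      (ofReal (-lam) • A.toBlock (· ∈ C) (· ∉ C))

end Matrices

/-! ### Critical values -/

section CriticalValues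

variable {V : Type*} [DecidableEq V]

/-- A square matrix whose rows and columns are indexed by a subset `nodes` of `V`. -/
structure IndexedMatrix (V : Type*) where
  nodes : Finset V
  mat : Matrix nodes nodes Rmin

/-- The critical nodes, as elements of `V`. -/
def IndexedMatrix.critical (S : IndexedMatrix V) : Finset V :=
  (criticalNodes S.mat).map (Function.Embedding.subtype _)

theorem IndexedMatrix.mem_nodes_of_mem_sdiff (S : IndexedMatrix V)
    (i : (S.nodes \ S.critical : Finset V)) : i.1 ∈ S.nodes :=
  (Finset.mem_sdiff.mp i.2).1

theorem IndexedMatrix.notMem_of_mem_sdiff (S : IndexedMatrix V)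
    (i : (S.nodes \ S.critical : Finset V)) :
    (⟨i.1, S.mem_nodes_of_mem_sdiff i⟩ : S.nodes) ∉ criticalNodes S.mat :=
  fun h => (Finset.mem_sdiff.mp i.2).2 (Finset.mem_map.mpr ⟨_, h, rfl⟩)

/-- The Schur complement of the critical nodes, with the minimal circuit mean as a parameter. It
inherits its indices from the given matrix. -/
def IndexedMatrix.next (S : IndexedMatrix V) : IndexedMatrix V where
  nodes := S.nodes \ S.critical
  mat := (schur (criticalNodes S.mat) (rhoMin S.mat) S.mat).submatrix
    (fun i => ⟨⟨i.1, S.mem_nodes_of_mem_sdiff i⟩, S.notMem_of_mem_sdiff i⟩)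
    (fun i => ⟨⟨i.1, S.mem_nodes_of_mem_sdiff i⟩, S.notMem_of_mem_sdiff i⟩)

variable [Fintype V]

/-- The matrices `A_1 = A` and `A_{ℓ+1} = Schur(C_ℓ, α_ℓ, A_ℓ)` for `ℓ ≥ 1`, with their index
sets. The indices start at `1`; the value at `0` is not used. -/
def reduced (A : Matrix V V Rmin) : ℕ → IndexedMatrix V
  | 0 => ⟨Finset.univ, A.submatrix Subtype.val Subtype.val⟩
  | 1 => ⟨Finset.univ, A.submatrix Subtype.val Subtype.val⟩
  | l + 2 => (reduced A (l + 1)).next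

/-- The critical value `α_ℓ = ρ_min(A_ℓ)`, for `ℓ ≥ 1`. -/
def alpha (A : Matrix V V Rmin) (l : ℕ) : ℝ := rhoMin (reduced A l).mat

/-- The set `C_ℓ` of the critical nodes of `A_ℓ`, for `ℓ ≥ 1`. -/
def critSet (A : Matrix V V Rmin) (l : ℕ) : Finset V := (reduced A l).critical

/-- The number `k` of critical values: the first index at which `C_1 ∪ ⋯ ∪ C_k` is the set of all
nodes. -/
def numCriticalValues (A : Matrix V V Rmin) : ℕ :=
  sInf {k | (Finset.Icc 1 k).biUnion (critSet A) = Finset.univ}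

/-- The number `|c|_C` of the arcs of the circuit `c` with initial node in `C`. -/
def countIn (C : Finset V) (c : List V) : ℕ := c.countP (· ∈ C)

/-- `|c|_A^ℓ = |c|_A - α_1 |c|_{C_1} - ⋯ - α_{ℓ-1} |c|_{C_{ℓ-1}}`. -/
def weightOfOrder (A : Matrix V V Rmin) (l : ℕ) (c : List V) : ℝ :=
  weight A c - ∑ m ∈ Finset.Ico 1 l, alpha A m * countIn (critSet A m) c

/-- `|c|^ℓ = |c| - |c|_{C_1} - ⋯ - |c|_{C_{ℓ-1}}`. -/
def lengthOfOrder (A : Matrix V V Rmin) (l : ℕ) (c : List V) : ℝ :=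
  c.length - ∑ m ∈ Finset.Ico 1 l, (countIn (critSet A m) c : ℝ)

/-- The circuit `c` of `G(A)` is critical of order `ℓ` if `|c|_A^ℓ = α_ℓ |c|^ℓ`. -/
def IsCriticalOfOrder (A : Matrix V V Rmin) (l : ℕ) (c : List V) : Prop :=
  (graphOf A).IsCircuit c ∧ weightOfOrder A l c = alpha A l * lengthOfOrder A l c

/-- The critical graph `G^c_ℓ(A)` of order `ℓ ≥ 1`, formed by the nodes and arcs of the critical
circuits of order `ℓ`; `G^c_0(A)` is the empty graph. -/
def critGraph (A : Matrix V V Rmin) : ℕ → Graph V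
  | 0 => ⟨∅, ∅⟩
  | l + 1 => graphOfCircuits {c | IsCriticalOfOrder A (l + 1) c}

/-- The formal characteristic polynomial `per(Y I ⊕ A)`. -/
def charPoly (A : Matrix V V Rmin) : Rmin[X] :=
  Matrix.permanent ((Polynomial.X : Rmin[X]) • (1 : Matrix V V Rmin[X]) + A.map Polynomial.C)

end CriticalValues

/-! ### Roots of min-plus polynomials -/

/-- `c = {c_1, …, c_n}` is the multiset of the roots of a formal polynomial `P` of degree `n`:
`P(y) = P_n (y ⊕ c_1) ⋯ (y ⊕ c_n)` for all `y` in the min-plus semiring. -/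
def IsRootMultiset (P : Rmin[X]) (c : Multiset Rmin) : Prop :=
  c.card = P.natDegree ∧ ∀ y : Rmin, P.eval y = P.leadingCoeff * (c.map fun r => y + r).prod

/-- `a` is a root of `P` of multiplicity exactly `m`: the function `y ↦ P(y)` has a factorization
as above in which `a` occurs, and in every such factorization `a` occurs exactly `m` times. -/
def IsRootOfMultiplicity (P : Rmin[X]) (a : Rmin) (m : ℕ) : Prop :=
  (∃ c, IsRootMultiset P c ∧ a ∈ c) ∧ ∀ c, IsRootMultiset P c → c.count a = m

end MinPlus

end

/-! Subtract from row `i` of `A` the number `level A l i`, equal to `α_m` on `C_m` for `m < l` and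
to `α_l` elsewhere. A Schur complement on the critical nodes contracts circuits, so an induction
along the chain `A_1, A_2, …` shows that no circuit becomes negative, that the circuits of weight
zero are the critical circuits of order `l`, and that they cover exactly `C_1 ∪ ⋯ ∪ C_l`
(`circuitWeight_level_aux`, `mem_nodes_critGraph`). Hence there is a potential `u` with `level i + u
i ≤ A i j + u j`, and equality holds on the arcs of the circuits of weight zero.

Now evaluate the permanent at `α_l`. A finite term is given by a permutation `σ` and a set `t` of
fixed points of `σ` at which `Y` is chosen. In the sum of the potential inequalities over the arcs
`(σ i, i)` the potential cancels, so the term is at least `∑ i, level i`. Equality saturates every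
arc: the nodes outside `t` then lie on circuits of weight zero, hence in `C_1 ∪ ⋯ ∪ C_l`, while
`level = α_l` on `t`, which therefore avoids `C_1 ∪ ⋯ ∪ C_{l-1}`, the critical values being strictly
increasing. So the terms attaining this bound have degrees between `m₁ = n - |C_1 ∪ ⋯ ∪ C_l|` and
`m₂ = n - |C_1 ∪ ⋯ ∪ C_{l-1}|` (`permTerm_bound`). The two disjoint circuit covers, read as
permutations, attain it in degrees `m₁` and `m₂` (`exists_permTerm_eq`).

The polynomial function thus has slope `m₁` just to the right of `α_l` and `m₂` just to the left. In
a product of linear factors the slope drops at `a` by the number of factors `y ⊕ a`, so the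
multiplicity is `m₂ - m₁ = |C_l|` (`isRootOfMultiplicity_of_eval`). -/

open scoped Polynomial

noncomputable section

namespace MinPlus

/-! ### Weights of paths and circuits -/

section Paths

variable {V : Type*}

/-- The arcs of the path that visits the nodes of `l` and then ends at `e`. -/
def pathArcs : List V → V → List (V × V)
  | [], _ => []
  | a :: l, e => (a, l.headD e) :: pathArcs l e

/-- The sum of the values of `f` along the path that visits the nodes of `l` and ends at `e`. -/
def pathWeight (f : V → V → WithTop ℝ) (l : List V) (e : V) : WithTop ℝ :=
  ((pathArcs l e).map fun a => f a.1 a.2).sum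

/-- The sum of the values of `f` along a circuit. -/
def circuitWeight (f : V → V → WithTop ℝ) (c : List V) : WithTop ℝ :=
  ((arcsOf c).map fun a => f a.1 a.2).sum

/-- Subtraction of `d i` from all the entries of row `i`. -/
def shift (f : V → V → WithTop ℝ) (d : V → ℝ) (i j : V) : WithTop ℝ :=
  f i j + ((-d i : ℝ) : WithTop ℝ)

@[simp] theorem pathWeight_nil (f : V → V → WithTop ℝ) (e : V) : pathWeight f [] e = 0 := rfl

@[simp] theorem pathWeight_cons (f : V → V → WithTop ℝ) (a : V) (l : List V) (e : V) :
    pathWeight f (a :: l) e = f a (l.headD e) + pathWeight f l e := by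
  simp [pathWeight, pathArcs]

theorem pathWeight_append (f : V → V → WithTop ℝ) (l₁ l₂ : List V) (e : V) :
    pathWeight f (l₁ ++ l₂) e = pathWeight f l₁ (l₂.headD e) + pathWeight f l₂ e := by
  induction l₁ with
  | nil => simp
  | cons a l ih =>
    simp [ih, add_assoc]

theorem pathArcs_eq_zip (l : List V) (e : V) : pathArcs l e = l.zip (l.tail ++ [e]) := by
  induction l with
  | nil => rfl
  | cons a l ih => cases l with
    | nil => rfl
    | cons b l => simp [pathArcs] at ih ⊢; exact ih

theorem arcsOf_cons (a : V) (l : List V) : arcsOf (a :: l) = pathArcs (a :: l) a := by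
  simp [arcsOf, pathArcs_eq_zip]

theorem arcsOf_eq_pathArcs {a : V} {c : List V} (h : c.head? = some a) :
    arcsOf c = pathArcs c a := by
  cases c with
  | nil => simp at h
  | cons b l => simp at h; subst h; exact arcsOf_cons _ _

theorem circuitWeight_cons (f : V → V → WithTop ℝ) (a : V) (l : List V) :
    circuitWeight f (a :: l) = pathWeight f (a :: l) a := by
  rw [circuitWeight, arcsOf_cons]; rfl

/-- Rotation invariance, which lets a circuit be opened at any of its nodes. -/
theorem circuitWeight_append_comm (f : V → V → WithTop ℝ) (l₁ l₂ : List V) :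
    circuitWeight f (l₁ ++ l₂) = circuitWeight f (l₂ ++ l₁) := by
  cases l₁ with
  | nil => simp
  | cons a l₁ => cases l₂ with
    | nil => simp
    | cons b l₂ =>
      rw [List.cons_append, circuitWeight_cons, List.cons_append, circuitWeight_cons,
        ← List.cons_append, ← List.cons_append, pathWeight_append, pathWeight_append]
      simp only [List.headD_cons]
      rw [add_comm]

theorem fst_mem_of_mem_arcsOf {c : List V} {a : V × V} (h : a ∈ arcsOf c) : a.1 ∈ c :=
  (List.of_mem_zip h).1

theorem snd_mem_of_mem_arcsOf {c : List V} {a : V × V} (h : a ∈ arcsOf c) : a.2 ∈ c := by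
  simpa using (List.of_mem_zip h).2

theorem map_fst_arcsOf (c : List V) : (arcsOf c).map Prod.fst = c := by
  simp [arcsOf, List.map_fst_zip]

theorem exists_mem_arcsOf {c : List V} {v : V} (h : v ∈ c) : ∃ w, (v, w) ∈ arcsOf c := by
  rw [← map_fst_arcsOf c] at h
  obtain ⟨⟨x, y⟩, hxy, rfl⟩ := List.mem_map.1 h
  exact ⟨y, hxy⟩

theorem arcsOf_map {W : Type*} (g : V → W) (c : List V) :
    arcsOf (c.map g) = (arcsOf c).map (Prod.map g g) := by
  rw [arcsOf, ← List.map_rotate, List.zip_map, arcsOf]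

theorem pathWeight_shift (f : V → V → WithTop ℝ) (d : V → ℝ) (l : List V) (e : V) :
    pathWeight (shift f d) l e = pathWeight f l e + ((-(l.map d).sum : ℝ) : WithTop ℝ) := by
  induction l with
  | nil => simp
  | cons a l ih =>
    simp only [pathWeight_cons, ih, shift, List.map_cons, List.sum_cons, neg_add]
    push_cast
    ac_rfl

theorem circuitWeight_shift (f : V → V → WithTop ℝ) (d : V → ℝ) (c : List V) :
    circuitWeight (shift f d) c = circuitWeight f c + ((-(c.map d).sum : ℝ) : WithTop ℝ) := by
  cases c with
  | nil => simp [circuitWeight, arcsOf]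
  | cons a l => rw [circuitWeight_cons, circuitWeight_cons, pathWeight_shift]

theorem add_coe_ne_top_iff {x : WithTop ℝ} {r : ℝ} : x + (r : WithTop ℝ) ≠ ⊤ ↔ x ≠ ⊤ := by
  simp

theorem circuitWeight_congr {f g : V → V → WithTop ℝ} {c : List V}
    (h : ∀ i ∈ c, ∀ j ∈ c, f i j = g i j) : circuitWeight f c = circuitWeight g c := by
  unfold circuitWeight
  congr 1
  exact List.map_congr_left fun a ha =>
    h _ (fst_mem_of_mem_arcsOf ha) _ (snd_mem_of_mem_arcsOf ha)

theorem sum_map_ne_top_iff {ι : Type*} (g : ι → WithTop ℝ) (l : List ι) :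
    (l.map g).sum ≠ ⊤ ↔ ∀ a ∈ l, g a ≠ ⊤ := by
  induction l with
  | nil => simp
  | cons a l ih => simp only [List.map_cons, List.sum_cons, WithTop.add_ne_top, ih,
      List.forall_mem_cons]

theorem circuitWeight_ne_top_iff (f : V → V → WithTop ℝ) (c : List V) :
    circuitWeight f c ≠ ⊤ ↔ ∀ a ∈ arcsOf c, f a.1 a.2 ≠ ⊤ := sum_map_ne_top_iff _ _

/-- A circuit of non-positive weight contains an elementary one. -/
theorem exists_nodup_circuitWeight_nonpos (f : V → V → WithTop ℝ) :
    ∀ (n : ℕ) (c : List V), c.length = n → c ≠ [] → circuitWeight f c ≤ 0 →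
      ∃ c' : List V, c' ≠ [] ∧ c'.Nodup ∧ circuitWeight f c' ≤ 0 := by
  intro n
  induction n using Nat.strong_induction_on with
  | _ n ih =>
    intro c hn hc hw
    by_cases hd : c.Nodup
    · exact ⟨c, hc, hd, hw⟩
    obtain ⟨v, hv⟩ : ∃ v, List.Duplicate v c := by
      by_contra h
      exact hd (List.nodup_iff_forall_not_duplicate.2 (by simpa using h))
    obtain ⟨l₁, l₂, rfl, h₂⟩ : ∃ l₁ l₂, c = l₁ ++ v :: l₂ ∧ v ∈ l₂ := by
      clear hn hc hw hd
      induction hv with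
      | cons_mem h => exact ⟨[], _, rfl, h⟩
      | @cons_duplicate y l _ ih =>
        obtain ⟨l₁, l₂, h, h'⟩ := ih
        exact ⟨y :: l₁, l₂, by simp [h], h'⟩
    obtain ⟨l₂, l₃, rfl⟩ := List.append_of_mem h₂
    -- Rotated to start at the repeated node `v`, the circuit splits there into `v :: l₂` and `v ::
    -- (l₃ ++ l₁)`. The weights add up, so one of the two shorter circuits is again non-positive.
    rw [circuitWeight_append_comm, List.cons_append, List.append_assoc, ← List.cons_append,
      List.cons_append, circuitWeight_cons, ← List.cons_append, pathWeight_append] at hw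
    simp only [List.cons_append, List.headD_cons] at hw
    rw [← circuitWeight_cons, ← circuitWeight_cons] at hw
    by_cases h1 : circuitWeight f (v :: l₂) ≤ 0
    · exact ih _ (by simp at hn ⊢; omega) _ rfl (by simp) h1
    · refine ih _ ?_ (v :: (l₃ ++ l₁)) rfl (by simp) ?_
      · simp at hn ⊢; omega
      · by_contra h2
        exact absurd hw (not_le.2 ((not_le.1 h1).trans_le
          (le_add_of_nonneg_right (not_le.1 h2).le)))

end Paths

/-! ### Potentials and saturated arcs -/

section Potentials

variable {V : Type*}

/-- A potential of `f`, for which all the arcs have a non-negative reduced weight. -/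
def IsPotential (f : V → V → WithTop ℝ) (u : V → ℝ) : Prop :=
  ∀ i j, (u i : WithTop ℝ) ≤ f i j + (u j : WithTop ℝ)

theorem IsPotential.le_pathWeight {f : V → V → WithTop ℝ} {u : V → ℝ} (hu : IsPotential f u)
    (l : List V) (e : V) : (u (l.headD e) : WithTop ℝ) ≤ pathWeight f l e + (u e : WithTop ℝ) := by
  induction l with
  | nil => simp
  | cons a l ih =>
    rw [pathWeight_cons, add_assoc]
    exact (hu a (l.headD e)).trans (by gcongr)

/-- The reduced weights `f i j + u j - u i` are non-negative and their sum telescopes along the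
path, so a total below `ε` bounds each of them by `ε`. The slack `ε` is kept because lifted circuits
are only known to weigh less than `ε`. -/
theorem IsPotential.arc_lt {f : V → V → WithTop ℝ} {u : V → ℝ} (hu : IsPotential f u) {ε : ℝ}
    (l : List V) (e : V)
    (h : pathWeight f l e + (u e : WithTop ℝ) < ((u (l.headD e) + ε : ℝ) : WithTop ℝ)) :
    ∀ a ∈ pathArcs l e, f a.1 a.2 + (u a.2 : WithTop ℝ) < ((u a.1 + ε : ℝ) : WithTop ℝ) := by
  induction l with
  | nil => simp [pathArcs]
  | cons a l ih =>
    have h1 := hu.le_pathWeight l e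
    have h2 := hu a (l.headD e)
    rw [pathWeight_cons] at h
    simp only [List.headD_cons] at h
    have ht : f a (l.headD e) ≠ ⊤ ∧ pathWeight f l e ≠ ⊤ := by
      constructor <;> intro h' <;> rw [h'] at h <;> simp at h
    obtain ⟨x, hx⟩ := WithTop.ne_top_iff_exists.1 ht.1
    obtain ⟨y, hy⟩ := WithTop.ne_top_iff_exists.1 ht.2
    rw [← hx, ← hy] at h
    rw [← hy] at h1
    rw [← hx] at h2
    norm_cast at h h1 h2
    simp only [pathArcs, List.forall_mem_cons]
    refine ⟨?_, ih ?_⟩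
    · rw [← hx]; norm_cast; linarith
    · rw [← hy]; norm_cast; linarith

theorem IsPotential.arc_lt_of_circuit {f : V → V → WithTop ℝ} {u : V → ℝ} (hu : IsPotential f u)
    {ε : ℝ} {c : List V} (h : circuitWeight f c < (ε : WithTop ℝ)) :
    ∀ a ∈ arcsOf c, f a.1 a.2 + (u a.2 : WithTop ℝ) < ((u a.1 + ε : ℝ) : WithTop ℝ) := by
  cases c with
  | nil => simp [arcsOf]
  | cons b l =>
    rw [arcsOf_cons]
    apply hu.arc_lt
    rw [circuitWeight_cons] at h
    rw [List.headD_cons, add_comm, WithTop.coe_add]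
    exact WithTop.add_lt_add_left WithTop.coe_ne_top h

theorem pathWeight_of_saturated {f : V → V → WithTop ℝ} {u : V → ℝ} (l : List V) (e : V)
    (h : ∀ a ∈ pathArcs l e, f a.1 a.2 + (u a.2 : WithTop ℝ) = (u a.1 : WithTop ℝ)) :
    pathWeight f l e + (u e : WithTop ℝ) = (u (l.headD e) : WithTop ℝ) := by
  induction l with
  | nil => simp
  | cons a l ih =>
    simp only [pathArcs, List.forall_mem_cons] at h
    rw [pathWeight_cons, add_assoc, ih h.2, h.1, List.headD_cons]

theorem circuitWeight_of_saturated {f : V → V → WithTop ℝ} {u : V → ℝ} {c : List V}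
    (h : ∀ a ∈ arcsOf c, f a.1 a.2 + (u a.2 : WithTop ℝ) = (u a.1 : WithTop ℝ)) :
    circuitWeight f c = 0 := by
  cases c with
  | nil => simp [circuitWeight, arcsOf]
  | cons b l =>
    rw [arcsOf_cons] at h
    have := pathWeight_of_saturated _ _ h
    rw [circuitWeight_cons]
    rw [List.headD_cons] at this
    exact (WithTop.add_left_inj (WithTop.coe_ne_top (a := u b))).1 
      (by rw [add_comm, this, add_zero])

theorem IsPotential.saturated_of_circuitWeight_nonpos {f : V → V → WithTop ℝ} {u : V → ℝ}
    (hu : IsPotential f u) {c : List V} (h : circuitWeight f c ≤ 0) :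
    ∀ a ∈ arcsOf c, f a.1 a.2 + (u a.2 : WithTop ℝ) = (u a.1 : WithTop ℝ) := by
  intro a ha
  have key : ∀ ε : ℝ, 0 < ε → f a.1 a.2 + (u a.2 : WithTop ℝ) < ((u a.1 + ε : ℝ) : WithTop ℝ) :=
    fun ε hε => hu.arc_lt_of_circuit (h.trans_lt (by exact_mod_cast hε)) a ha
  have ht : f a.1 a.2 ≠ ⊤ := by
    intro h'
    have := key 1 one_pos
    simp [h'] at this
  refine le_antisymm ?_ (hu _ _)
  obtain ⟨x, hx⟩ := WithTop.ne_top_iff_exists.1 ht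
  rw [← hx] at key ⊢
  norm_cast
  refine le_of_forall_pos_lt_add fun ε hε => ?_
  exact_mod_cast key ε hε

/-- The finite positive reduced weights of a potential are bounded away from zero. -/
theorem IsPotential.exists_gap [Finite V] {f : V → V → WithTop ℝ} {u : V → ℝ}
    (hu : IsPotential f u) :
    ∃ ε : ℝ, 0 < ε ∧ ∀ c, circuitWeight f c < (ε : WithTop ℝ) → circuitWeight f c = 0 := by
  have h1 : ∀ a : V × V, ∀ᶠ ε : ℝ in nhdsWithin 0 (Set.Ioi 0),
      f a.1 a.2 + (u a.2 : WithTop ℝ) < ((u a.1 + ε : ℝ) : WithTop ℝ) →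
        f a.1 a.2 + (u a.2 : WithTop ℝ) = (u a.1 : WithTop ℝ) := by
    intro a
    have ha := hu a.1 a.2
    rcases eq_or_ne (f a.1 a.2) ⊤ with ht | ht
    · simp [ht]
    obtain ⟨x, hx⟩ := WithTop.ne_top_iff_exists.1 ht
    rw [← hx] at ha ⊢
    norm_cast at ha ⊢
    rcases ha.eq_or_lt with h | h
    · exact Filter.Eventually.of_forall fun _ _ => h.symm
    · have : ∀ᶠ ε : ℝ in nhdsWithin 0 (Set.Ioi 0), ε < x + u a.2 - u a.1 :=
        nhdsWithin_le_nhds (Iio_mem_nhds (by linarith))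
      filter_upwards [this] with ε hε h'
      linarith
  obtain ⟨ε, hε, hpos⟩ := ((Filter.eventually_all.2 h1).and self_mem_nhdsWithin).exists
  exact ⟨ε, hpos, fun c hc => circuitWeight_of_saturated fun a ha =>
    hε a (hu.arc_lt_of_circuit hc a ha)⟩

/-- The entries of `f` other than `⊤` join any two nodes of `s`, and there are none outside. -/
def ConnectedOn (f : V → V → WithTop ℝ) (s : Set V) : Prop :=
  (∀ i ∈ s, ∀ j ∈ s, ∃ l, pathWeight f (i :: l) j ≠ ⊤) ∧
    ∀ i j, f i j ≠ ⊤ → i ∈ s ∧ j ∈ s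

theorem ConnectedOn.shift {f : V → V → WithTop ℝ} {s : Set V} (h : ConnectedOn f s) (d : V → ℝ) :
    ConnectedOn (shift f d) s := by
  refine ⟨fun i hi j hj => ?_, fun i j hij => h.2 i j ?_⟩
  · obtain ⟨l, hl⟩ := h.1 i hi j hj
    exact ⟨l, by rwa [pathWeight_shift, add_coe_ne_top_iff]⟩
  · rwa [MinPlus.shift, add_coe_ne_top_iff] at hij

/-- If no circuit has a negative weight, the least weights of the paths to a fixed node form a
potential. -/
theorem ConnectedOn.exists_potential {f : V → V → WithTop ℝ} {s : Set V} (h : ConnectedOn f s)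
    (hc : ∀ c, 0 ≤ circuitWeight f c) : ∃ u, IsPotential f u := by
  rcases s.eq_empty_or_nonempty with rfl | ⟨i₀, hi₀⟩
  · refine ⟨0, fun i j => ?_⟩
    have : f i j = ⊤ := by
      by_contra hne
      exact (h.2 i j hne).1
    simp [this]
  let T : V → Set ℝ := fun i => {x | ∃ l, pathWeight f (i :: l) i₀ = (x : WithTop ℝ)}
  have hne : ∀ i ∈ s, (T i).Nonempty := by
    intro i hi
    obtain ⟨l, hl⟩ := h.1 i hi i₀ hi₀
    obtain ⟨x, hx⟩ := WithTop.ne_top_iff_exists.1 hl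
    exact ⟨x, l, hx.symm⟩
  have hbd : ∀ i ∈ s, BddBelow (T i) := by
    intro i hi
    obtain ⟨l, hl⟩ := h.1 i₀ hi₀ i hi
    obtain ⟨x, hx⟩ := WithTop.ne_top_iff_exists.1 hl
    refine ⟨-x, ?_⟩
    rintro y ⟨l', hy⟩
    -- A fixed return path from `i₀` to `i` closes each path into a circuit of non-negative weight,
    -- which bounds the path weights below.
    have h1 := hc (i :: l' ++ i₀ :: l)
    rw [List.cons_append, circuitWeight_cons, ← List.cons_append, pathWeight_append,
      List.headD_cons, hy, ← hx] at h1
    norm_cast at h1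
    linarith
  -- Outside `s` the set `T i` is empty and the infimum is a default value, which is harmless since
  -- no finite entry involves such a node.
  refine ⟨fun i => sInf (T i), fun i j => ?_⟩
  rcases eq_or_ne (f i j) ⊤ with ht | ht
  · simp [ht]
  obtain ⟨hi, hj⟩ := h.2 i j ht
  obtain ⟨x, hx⟩ := WithTop.ne_top_iff_exists.1 ht
  rw [← hx]
  norm_cast
  rw [← sub_le_iff_le_add']
  refine le_csInf (hne j hj) ?_
  rintro y ⟨l, hl⟩
  rw [sub_le_iff_le_add']
  refine csInf_le (hbd i hi) ⟨j :: l, ?_⟩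
  rw [pathWeight_cons, hl, List.headD_cons, ← hx]
  norm_cast

end Potentials

/-! ### The minimal circuit mean -/

section RhoMin

variable {L : Type*}

/-- The entries of a min-plus matrix, seen in `WithTop ℝ`. -/
def value (A : Matrix L L Rmin) (i j : L) : WithTop ℝ := Tropical.untrop (A i j)

theorem value_ne_top_iff {A : Matrix L L Rmin} {i j : L} : value A i j ≠ ⊤ ↔ A i j ≠ 0 := by
  rw [value, Ne, Ne, ← Tropical.untrop_inj_iff, Tropical.untrop_zero]

theorem isCircuit_iff {A : Matrix L L Rmin} {c : List L} :
    (graphOf A).IsCircuit c ↔ c ≠ [] ∧ circuitWeight (value A) c ≠ ⊤ := by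
  simp [Graph.IsCircuit, graphOf, circuitWeight_ne_top_iff, ← value_ne_top_iff]

theorem sum_map_untopD {ι : Type*} (g : ι → WithTop ℝ) (l : List ι) (h : ∀ a ∈ l, g a ≠ ⊤) :
    (l.map g).sum = (((l.map fun a => (g a).untopD 0).sum : ℝ) : WithTop ℝ) := by
  induction l with
  | nil => simp
  | cons a l ih =>
    rw [List.forall_mem_cons] at h
    obtain ⟨x, hx⟩ := WithTop.ne_top_iff_exists.1 h.1
    simp [ih h.2, ← hx]

theorem circuitWeight_value {A : Matrix L L Rmin} {c : List L}
    (h : circuitWeight (value A) c ≠ ⊤) :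
    circuitWeight (value A) c = (weight A c : WithTop ℝ) :=
  sum_map_untopD _ _ ((circuitWeight_ne_top_iff _ _).1 h)

theorem circuitWeight_shift_const (f : L → L → WithTop ℝ) (r : ℝ) (c : List L) :
    circuitWeight (shift f fun _ => r) c =
      circuitWeight f c + ((-(c.length * r) : ℝ) : WithTop ℝ) := by
  simp [circuitWeight_shift]

/-- The minimal circuit mean is attained. -/
theorem exists_mean_le [Finite L] {A : Matrix L L Rmin} (h : ∃ c, (graphOf A).IsCircuit c) :
    ∃ c, (graphOf A).IsCircuit c ∧ ∀ c', (graphOf A).IsCircuit c' →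
      weight A c / c.length ≤ weight A c' / c'.length := by
  classical
  have := Fintype.ofFinite L
  -- After subtraction of its own mean a circuit has weight zero, so it contains an elementary
  -- circuit of no larger mean; there are finitely many elementary circuits.
  have red : ∀ c, (graphOf A).IsCircuit c → ∃ c', c'.Nodup ∧ (graphOf A).IsCircuit c' ∧
      weight A c' / c'.length ≤ weight A c / c.length := by
    intro c hc
    obtain ⟨hne, hw⟩ := isCircuit_iff.1 hc
    have hlen : (0 : ℝ) < c.length := by
      exact_mod_cast List.length_pos_iff.2 hne
    obtain ⟨c', hne', hnd, hw'⟩ := exists_nodup_circuitWeight_nonpos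
      (shift (value A) fun _ => weight A c / c.length) _ c rfl hne (by
        rw [circuitWeight_shift_const, circuitWeight_value hw]
        norm_cast
        rw [mul_div_cancel₀ _ hlen.ne']
        simp)
    have hlen' : (0 : ℝ) < c'.length := by
      exact_mod_cast List.length_pos_iff.2 hne'
    rw [circuitWeight_shift_const] at hw'
    have ht : circuitWeight (value A) c' ≠ ⊤ := by
      intro ht
      simp [ht] at hw'
    rw [circuitWeight_value ht] at hw'
    refine ⟨c', hnd, isCircuit_iff.2 ⟨hne', ht⟩, ?_⟩
    norm_cast at hw'
    rw [div_le_iff₀ hlen']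
    linarith
  have hfin : {c | c.Nodup ∧ (graphOf A).IsCircuit c}.Finite :=
    (List.finite_length_le L (Fintype.card L)).subset fun c hc => hc.1.length_le_card
  obtain ⟨c₀, hc₀⟩ := h
  obtain ⟨c₁, h₁, h₁', -⟩ := red c₀ hc₀
  obtain ⟨c, ⟨-, hc⟩, hmin⟩ := Set.exists_min_image _ (fun c => weight A c / c.length) hfin
    ⟨c₁, h₁, h₁'⟩
  refine ⟨c, hc, fun c' hc' => ?_⟩
  obtain ⟨c₂, h₂, h₂', h₃⟩ := red c' hc'
  exact (hmin c₂ ⟨h₂, h₂'⟩).trans h₃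

theorem exists_isCriticalCircuit [Finite L] {A : Matrix L L Rmin}
    (h : ∃ c, (graphOf A).IsCircuit c) : ∃ c, IsCriticalCircuit A c := by
  obtain ⟨c, hc, hmin⟩ := exists_mean_le h
  refine ⟨c, hc, ?_⟩
  have : IsLeast {x | ∃ c, (graphOf A).IsCircuit c ∧ x = weight A c / c.length}
      (weight A c / c.length) :=
    ⟨⟨c, hc, rfl⟩, by rintro x ⟨c', hc', rfl⟩; exact hmin c' hc'⟩
  exact this.csInf_eq.symm

theorem circuitWeight_shift_rhoMin_nonneg [Finite L] (A : Matrix L L Rmin) (c : List L) :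
    0 ≤ circuitWeight (shift (value A) fun _ => rhoMin A) c := by
  rcases eq_or_ne c [] with rfl | hne
  · simp [circuitWeight, arcsOf]
  rw [circuitWeight_shift_const]
  rcases eq_or_ne (circuitWeight (value A) c) ⊤ with ht | ht
  · simp [ht]
  have hc := isCircuit_iff.2 ⟨hne, ht⟩
  obtain ⟨c₀, hc₀, hmin⟩ := exists_mean_le ⟨c, hc⟩
  have hr : rhoMin A ≤ weight A c / c.length :=
    csInf_le ⟨_, by rintro x ⟨c', hc', rfl⟩; exact hmin c' hc'⟩ ⟨c, hc, rfl⟩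
  rw [circuitWeight_value ht]
  norm_cast
  rw [le_div_iff₀ (by exact_mod_cast List.length_pos_iff.2 hne)] at hr
  linarith

theorem isCriticalCircuit_iff {A : Matrix L L Rmin} {c : List L} :
    IsCriticalCircuit A c ↔
      c ≠ [] ∧ circuitWeight (shift (value A) fun _ => rhoMin A) c = 0 := by
  rw [IsCriticalCircuit, isCircuit_iff, circuitWeight_shift_const, and_assoc]
  refine and_congr_right fun hne => ?_
  have hlen : (c.length : ℝ) ≠ 0 := by exact_mod_cast (List.length_pos_iff.2 hne).ne'
  rcases eq_or_ne (circuitWeight (value A) c) ⊤ with ht | ht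
  · simp [ht]
  · rw [circuitWeight_value ht]
    norm_cast
    rw [div_eq_iff hlen]
    simp only [WithTop.coe_ne_top, not_false_eq_true, true_and]
    constructor <;> intro h <;> linarith

end RhoMin

/-! ### Indexed matrices as functions on all of `V` -/

section Entries

variable {V : Type*} [DecidableEq V]

/-- The entries of an indexed matrix, extended by `+∞`. -/
def IndexedMatrix.entry (S : IndexedMatrix V) (i j : V) : WithTop ℝ :=
  if h : i ∈ S.nodes ∧ j ∈ S.nodes then value S.mat ⟨i, h.1⟩ ⟨j, h.2⟩ else ⊤

theorem IndexedMatrix.entry_coe (S : IndexedMatrix V) (i j : S.nodes) :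
    S.entry i j = value S.mat i j := by
  simp [IndexedMatrix.entry]

theorem IndexedMatrix.mem_of_entry_ne_top {S : IndexedMatrix V} {i j : V}
    (h : S.entry i j ≠ ⊤) : i ∈ S.nodes ∧ j ∈ S.nodes := by
  by_contra h'
  exact h (by simp only [IndexedMatrix.entry, dif_neg h'])

theorem IndexedMatrix.circuitWeight_map (S : IndexedMatrix V) (d : V → ℝ) (c : List S.nodes) :
    circuitWeight (shift S.entry d) (c.map Subtype.val) =
      circuitWeight (shift (value S.mat) fun i => d i) c := by
  rw [circuitWeight, arcsOf_map, List.map_map, circuitWeight]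
  congr 1
  refine List.map_congr_left fun a _ => ?_
  simp [shift, IndexedMatrix.entry_coe]

theorem IndexedMatrix.mem_of_circuitWeight_ne_top {S : IndexedMatrix V} {d : V → ℝ} {c : List V}
    (h : circuitWeight (shift S.entry d) c ≠ ⊤) : ∀ v ∈ c, v ∈ S.nodes := by
  intro v hv
  rw [circuitWeight_shift, add_coe_ne_top_iff] at h
  obtain ⟨w, hw⟩ := exists_mem_arcsOf hv
  exact (IndexedMatrix.mem_of_entry_ne_top ((circuitWeight_ne_top_iff _ _).1 h _ hw)).1

theorem IndexedMatrix.exists_eq_map {S : IndexedMatrix V} {d : V → ℝ} {c : List V}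
    (h : circuitWeight (shift S.entry d) c ≠ ⊤) : ∃ c' : List S.nodes, c'.map Subtype.val = c := by
  have := IndexedMatrix.mem_of_circuitWeight_ne_top h
  lift c to List S.nodes using this
  exact ⟨c, rfl⟩

theorem IndexedMatrix.rhoMin_le (S : IndexedMatrix V) (c : List V) :
    0 ≤ circuitWeight (shift S.entry fun _ => rhoMin S.mat) c := by
  rcases eq_or_ne (circuitWeight (shift S.entry fun _ => rhoMin S.mat) c) ⊤ with ht | ht
  · simp [ht]
  obtain ⟨c, rfl⟩ := IndexedMatrix.exists_eq_map ht
  rw [IndexedMatrix.circuitWeight_map]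
  exact circuitWeight_shift_rhoMin_nonneg _ _

theorem IndexedMatrix.mem_critical_iff {S : IndexedMatrix V} {v : V} :
    v ∈ S.critical ↔
      ∃ c, v ∈ c ∧ circuitWeight (shift S.entry fun _ => rhoMin S.mat) c = 0 := by
  simp only [IndexedMatrix.critical, criticalNodes, Finset.mem_map, Finset.mem_filter,
    Finset.mem_univ, true_and, Function.Embedding.coe_subtype]
  constructor
  · rintro ⟨w, ⟨c, hc, hw⟩, rfl⟩
    refine ⟨c.map Subtype.val, List.mem_map_of_mem hw, ?_⟩
    rw [IndexedMatrix.circuitWeight_map]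
    exact (isCriticalCircuit_iff.1 hc).2
  · rintro ⟨c, hv, hc⟩
    obtain ⟨c, rfl⟩ := IndexedMatrix.exists_eq_map (S := S) (hc ▸ WithTop.zero_ne_top)
    rw [IndexedMatrix.circuitWeight_map] at hc
    obtain ⟨w, hw, rfl⟩ := List.mem_map.1 hv
    exact ⟨w, ⟨c, isCriticalCircuit_iff.2 ⟨List.ne_nil_of_mem hw, hc⟩, hw⟩, rfl⟩

theorem IndexedMatrix.critical_subset (S : IndexedMatrix V) : S.critical ⊆ S.nodes := by
  intro v hv
  obtain ⟨c, hv, hc⟩ := IndexedMatrix.mem_critical_iff.1 hv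
  exact IndexedMatrix.mem_of_circuitWeight_ne_top (hc ▸ WithTop.zero_ne_top) v hv

omit [DecidableEq V] in
theorem IndexedMatrix.mem_critical_coe {S : IndexedMatrix V} {v : S.nodes} :
    v.1 ∈ S.critical ↔ v ∈ criticalNodes S.mat := by
  simp [IndexedMatrix.critical]

/-- Any two nodes are joined by a path of positive length. -/
def IndexedMatrix.Connected (S : IndexedMatrix V) : Prop := ConnectedOn S.entry S.nodes

theorem IndexedMatrix.Connected.critical_nonempty {S : IndexedMatrix V} (h : S.Connected)
    (hne : S.nodes.Nonempty) : S.critical.Nonempty := by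
  obtain ⟨i, hi⟩ := hne
  obtain ⟨l, hl⟩ := h.1 i hi i hi
  have h0 : circuitWeight (shift S.entry 0) (i :: l) ≠ ⊤ := by
    rwa [circuitWeight_shift, add_coe_ne_top_iff, circuitWeight_cons]
  obtain ⟨c, hc⟩ := IndexedMatrix.exists_eq_map h0
  rw [← hc, IndexedMatrix.circuitWeight_map, circuitWeight_shift, add_coe_ne_top_iff] at h0
  obtain ⟨c', hc'⟩ := exists_isCriticalCircuit
    ⟨c, isCircuit_iff.2 ⟨by rintro rfl; simp at hc, h0⟩⟩
  obtain ⟨hne', hw⟩ := isCriticalCircuit_iff.1 hc'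
  obtain ⟨v, hv⟩ := List.exists_mem_of_ne_nil _ hne'
  refine ⟨v, IndexedMatrix.mem_critical_iff.2 ⟨c'.map Subtype.val, List.mem_map_of_mem hv, ?_⟩⟩
  rw [IndexedMatrix.circuitWeight_map, hw]

end Entries

/-! ### Kleene's star and paths -/

section Star

variable {I J K : Type*} [Fintype J]

theorem untrop_mul_apply_le (M : Matrix I J Rmin) (N : Matrix J K Rmin) (i : I) (j : J) (k : K) :
    Tropical.untrop ((M * N) i k) ≤ Tropical.untrop (M i j) + Tropical.untrop (N j k) := by
  rw [Matrix.mul_apply, Finset.untrop_sum', ← Tropical.untrop_mul]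
  exact Finset.inf_le (f := Tropical.untrop ∘ fun j => M i j * N j k) (Finset.mem_univ j)

theorem exists_untrop_mul_apply_eq {M : Matrix I J Rmin} {N : Matrix J K Rmin} {i : I} {k : K}
    (h : Tropical.untrop ((M * N) i k) ≠ ⊤) :
    ∃ j, Tropical.untrop ((M * N) i k) = Tropical.untrop (M i j) + Tropical.untrop (N j k) := by
  rw [Matrix.mul_apply, Finset.untrop_sum'] at h ⊢
  have hne : (Finset.univ : Finset J).Nonempty := by
    by_contra h'
    rw [Finset.not_nonempty_iff_eq_empty] at h'
    simp [h'] at h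
  obtain ⟨j, -, hj⟩ := Finset.exists_mem_eq_inf _ hne (Tropical.untrop ∘ fun j => M i j * N j k)
  exact ⟨j, by rw [hj, Function.comp_apply, Tropical.untrop_mul]⟩

variable [DecidableEq J]

/-- A common potential bounds all powers below at once, so that the infimum in `kleeneStar` is a
genuine one. -/
theorem IsPotential.pow {M : Matrix J J Rmin} {u : J → ℝ} (hu : IsPotential (value M) u) (k : ℕ) :
    IsPotential (value (M ^ k)) u := by
  induction k with
  | zero =>
    intro i j
    rcases eq_or_ne i j with rfl | h
    · simp [value]
    · simp [value, h]
  | succ k ih =>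
    intro i j
    rcases eq_or_ne (value (M ^ (k + 1)) i j) ⊤ with ht | ht
    · simp [ht]
    rw [pow_succ'] at ht ⊢
    obtain ⟨l, hl⟩ := exists_untrop_mul_apply_eq ht
    rw [value, hl, add_assoc]
    exact (hu i l).trans (add_le_add_right (ih l j) _)

theorem IsPotential.bddBelow {M : Matrix J J Rmin} {u : J → ℝ} (hu : IsPotential (value M) u)
    (i j : J) : BddBelow (Set.range fun k : ℕ => Tropical.untrop ((M ^ k) i j)) := by
  refine ⟨((u i - u j : ℝ) : WithTop ℝ), ?_⟩
  rintro _ ⟨k, rfl⟩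
  have := hu.pow k i j
  rw [value] at this
  rcases eq_or_ne (Tropical.untrop ((M ^ k) i j)) ⊤ with ht | ht
  · simp [ht]
  · obtain ⟨x, hx⟩ := WithTop.ne_top_iff_exists.1 ht
    simp only [← hx] at this ⊢
    norm_cast at this ⊢
    linarith

theorem IsPotential.kleeneStar_le {M : Matrix J J Rmin} {u : J → ℝ} (hu : IsPotential (value M) u)
    (k : ℕ) (i j : J) : value (kleeneStar M) i j ≤ value (M ^ k) i j :=
  ciInf_le (hu.bddBelow i j) k

/-- Prefixing the arc `(i, l)` turns the bound by `M ^ k` into one by `M ^ (k + 1)`; as the arc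
weight is finite it can be moved across the inequality before taking the infimum. -/
theorem IsPotential.kleeneStar_le_add {M : Matrix J J Rmin} {u : J → ℝ}
    (hu : IsPotential (value M) u) (i l j : J) :
    value (kleeneStar M) i j ≤ value M i l + value (kleeneStar M) l j := by
  rcases eq_or_ne (value M i l) ⊤ with ht | ht
  · simp [ht]
  obtain ⟨x, hx⟩ := WithTop.ne_top_iff_exists.1 ht
  have h : ∀ k, value (kleeneStar M) i j ≤ (x : WithTop ℝ) + value (M ^ k) l j := fun k => by
    refine (hu.kleeneStar_le (k + 1) i j).trans ?_
    rw [pow_succ', hx]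
    exact untrop_mul_apply_le _ _ _ _ _
  rw [← hx]
  have h2 : value (kleeneStar M) i j + ((-x : ℝ) : WithTop ℝ) ≤ value (kleeneStar M) l j := by
    refine le_ciInf fun k => ?_
    have := add_le_add_left (h k) ((-x : ℝ) : WithTop ℝ)
    rwa [add_comm (x : WithTop ℝ), add_assoc, ← WithTop.coe_add, add_neg_cancel, WithTop.coe_zero,
      add_zero] at this
  have := add_le_add_right h2 (x : WithTop ℝ)
  rwa [add_left_comm, ← WithTop.coe_add, add_neg_cancel, WithTop.coe_zero, add_zero] at this

variable {V : Type*} {f : V → V → WithTop ℝ} {g : J → V} {e : V}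

theorem IsPotential.kleeneStar_mul_le {M : Matrix J J Rmin} {D : Matrix J K Rmin} {k : K}
    (hf : ∀ a b, value M a b = f (g a) (g b)) (hD : ∀ b, Tropical.untrop (D b k) = f (g b) e)
    {u : J → ℝ} (hu : IsPotential (value M) u) (t : List J) (a : J) :
    Tropical.untrop ((kleeneStar M * D) a k) ≤ pathWeight f ((a :: t).map g) e := by
  induction t generalizing a with
  | nil =>
    refine (untrop_mul_apply_le _ _ _ a _).trans ?_
    have h0 := hu.kleeneStar_le 0 a a
    rw [List.map_cons, List.map_nil, pathWeight_cons, pathWeight_nil, add_zero, List.headD_nil,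
      ← hD]
    simp only [value, pow_zero, Matrix.one_apply_eq, Tropical.untrop_one] at h0
    exact (add_le_add_left h0 _).trans (zero_add _).le
  | cons b t ih =>
    rw [List.map_cons, pathWeight_cons]
    refine le_trans ?_ (add_le_add_right (ih b) _)
    rw [List.map_cons, List.headD_cons, ← hf]
    rcases eq_or_ne (Tropical.untrop ((kleeneStar M * D) b k)) ⊤ with ht | ht
    · simp [ht]
    obtain ⟨l, hl⟩ := exists_untrop_mul_apply_eq ht
    rw [hl, ← add_assoc]
    exact (untrop_mul_apply_le _ _ _ l _).trans
      (add_le_add_left (hu.kleeneStar_le_add a b l) _)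

theorem exists_pathWeight_le_pow {M : Matrix J J Rmin}
    (hf : ∀ a b, value M a b = f (g a) (g b)) (n : ℕ) (a b : J) :
    ∃ t, pathWeight f ((a :: t).map g) e ≤ value (M ^ n) a b + f (g b) e := by
  induction n generalizing a with
  | zero =>
    rcases eq_or_ne a b with rfl | h
    · exact ⟨[], by simp [value]⟩
    · exact ⟨[], by simp [value, h]⟩
  | succ n ih =>
    rcases eq_or_ne (value (M ^ (n + 1)) a b) ⊤ with ht | ht
    · exact ⟨[], by simp [ht]⟩
    rw [pow_succ'] at ht ⊢
    obtain ⟨l, hl⟩ := exists_untrop_mul_apply_eq ht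
    obtain ⟨t, h⟩ := ih l
    refine ⟨l :: t, ?_⟩
    rw [value, hl, List.map_cons, pathWeight_cons, add_assoc, List.map_cons, List.headD_cons,
      ← hf]
    exact add_le_add_right h _

/-- A strict upper bound on the infimum is already met by some power, whose entries are realized by
paths. The inequality stays strict because attainment of the infimum is not established. -/
theorem exists_pathWeight_lt {M : Matrix J J Rmin} {D : Matrix J K Rmin} {k : K}
    (hf : ∀ a b, value M a b = f (g a) (g b)) (hD : ∀ b, Tropical.untrop (D b k) = f (g b) e)
    {a : J} {x : WithTop ℝ} (h : Tropical.untrop ((kleeneStar M * D) a k) < x) :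
    ∃ t, pathWeight f ((a :: t).map g) e < x := by
  obtain ⟨l, hl⟩ := exists_untrop_mul_apply_eq h.ne_top
  have hne := h.ne_top
  rw [hl] at hne h
  obtain ⟨y, hy⟩ := WithTop.ne_top_iff_exists.1 (WithTop.add_ne_top.1 hne).2
  obtain ⟨n, hn⟩ : ∃ n : ℕ, value (M ^ n) a l + (y : WithTop ℝ) < x := by
    by_contra! hcon
    refine h.not_ge ?_
    rw [← hy]
    have h2 : x + ((-y : ℝ) : WithTop ℝ) ≤ value (kleeneStar M) a l := by
      refine le_ciInf fun n => ?_
      have := add_le_add_left (hcon n) ((-y : ℝ) : WithTop ℝ)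
      rwa [add_assoc, ← WithTop.coe_add, add_neg_cancel, WithTop.coe_zero, add_zero] at this
    have := add_le_add_left h2 (y : WithTop ℝ)
    rwa [add_assoc, ← WithTop.coe_add, neg_add_cancel, WithTop.coe_zero, add_zero] at this
  obtain ⟨t, ht⟩ := exists_pathWeight_le_pow (e := e) hf n a l
  rw [← hD, ← hy] at ht
  exact ⟨t, ht.trans_lt hn⟩

end Star

/-! ### Contraction and lifting through a Schur complement -/

section Schur

variable {V : Type*} [DecidableEq V]

theorem IndexedMatrix.Connected.exists_potential {S : IndexedMatrix V} (h : S.Connected) :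
    ∃ u, IsPotential (shift S.entry fun _ => rhoMin S.mat) u :=
  ConnectedOn.exists_potential (ConnectedOn.shift h _) S.rhoMin_le

/-- The entries of the Schur complement, with the notations of `schur`. -/
theorem IndexedMatrix.next_entry (S : IndexedMatrix V) {i j : V} (hi : i ∈ S.nodes)
    (hj : j ∈ S.nodes) (hi' : ⟨i, hi⟩ ∉ criticalNodes S.mat)
    (hj' : ⟨j, hj⟩ ∉ criticalNodes S.mat) :
    S.next.entry i j = min (S.entry i j)
      (Tropical.untrop
        ((S.mat.toBlock (· ∉ criticalNodes S.mat) (· ∈ criticalNodes S.mat) *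
          (kleeneStar (ofReal (-rhoMin S.mat) •
            S.mat.toBlock (· ∈ criticalNodes S.mat) (· ∈ criticalNodes S.mat)) *
          (ofReal (-rhoMin S.mat) •
            S.mat.toBlock (· ∈ criticalNodes S.mat) (· ∉ criticalNodes S.mat))))
          ⟨⟨i, hi⟩, hi'⟩ ⟨⟨j, hj⟩, hj'⟩)) := by
  have mem : ∀ {v : V} (h : v ∈ S.nodes), ⟨v, h⟩ ∉ criticalNodes S.mat → v ∈ S.next.nodes :=
    fun h h' => Finset.mem_sdiff.2 ⟨h, fun hc => h' (IndexedMatrix.mem_critical_coe.1 hc)⟩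
  rw [S.next.entry_coe ⟨i, mem hi hi'⟩ ⟨j, mem hj hj'⟩, S.entry_coe ⟨i, hi⟩ ⟨j, hj⟩,
    ← Matrix.mul_assoc]
  rfl

theorem untrop_ofReal_smul {I J : Type*} (r : ℝ) (M : Matrix I J Rmin) (i : I) (j : J) :
    Tropical.untrop ((ofReal (-r) • M) i j) =
      Tropical.untrop (M i j) + ((-r : ℝ) : WithTop ℝ) := by
  rw [Matrix.smul_apply, smul_eq_mul, Tropical.untrop_mul, add_comm]
  rfl

variable {S : IndexedMatrix V} {d : V → ℝ} {i j : V}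

theorem IndexedMatrix.mem_next_nodes {v : V} :
    v ∈ S.next.nodes ↔ v ∈ S.nodes ∧ v ∉ S.critical := Finset.mem_sdiff

theorem IndexedMatrix.exists_of_mem_next_nodes {v : V} (h : v ∈ S.next.nodes) :
    ∃ hv : v ∈ S.nodes, ⟨v, hv⟩ ∉ criticalNodes S.mat :=
  ⟨(IndexedMatrix.mem_next_nodes.1 h).1, fun h' =>
    (IndexedMatrix.mem_next_nodes.1 h).2 (IndexedMatrix.mem_critical_coe.2 h')⟩

/-- A detour through critical nodes is one of the paths counted by the star. The shift has to equal
the minimal mean on critical rows, to match the factors `lam⁻¹` in `schur`, and is free on the other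
rows. -/
theorem IndexedMatrix.Connected.next_entry_le (h : S.Connected)
    (hd : ∀ v ∈ S.critical, d v = rhoMin S.mat) (hi : i ∈ S.next.nodes) (hj : j ∈ S.next.nodes)
    {s : List V} (hs : ∀ v ∈ s, v ∈ S.critical) :
    shift S.next.entry d i j ≤ pathWeight (shift S.entry d) (i :: s) j := by
  obtain ⟨hi, hi'⟩ := IndexedMatrix.exists_of_mem_next_nodes hi
  obtain ⟨hj, hj'⟩ := IndexedMatrix.exists_of_mem_next_nodes hj
  rw [shift, S.next_entry hi hj hi' hj']
  cases s with
  | nil =>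
    rw [pathWeight_cons, pathWeight_nil, add_zero, List.headD_nil, shift]
    exact add_le_add_left (min_le_left _ _) _
  | cons a t =>
    obtain ⟨t', ht'⟩ : ∃ t' : List {i : S.nodes // i ∈ criticalNodes S.mat},
        t'.map (fun x => x.1.1) = a :: t := by
      refine ⟨(a :: t).pmap (fun v hv => ⟨⟨v, S.critical_subset hv⟩,
        IndexedMatrix.mem_critical_coe.1 hv⟩) hs, ?_⟩
      rw [List.map_pmap]
      simp
    cases t' with
    | nil => simp at ht'
    | cons a' t' =>
      obtain ⟨u, hu⟩ := h.exists_potential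
      rw [← ht', pathWeight_cons, List.map_cons, List.headD_cons, shift, add_right_comm]
      refine add_le_add_left
        ((min_le_right _ _).trans ((untrop_mul_apply_le _ _ _ a' _).trans ?_)) _
      refine add_le_add
        (S.entry_coe ⟨i, hi⟩ a'.1).symm.le
        (IsPotential.kleeneStar_mul_le (u := fun x => u x.1.1)
          (g := fun x : {i : S.nodes // i ∈ criticalNodes S.mat} => x.1.1) ?_ ?_ ?_ _ _)
      · intro a b
        rw [value, untrop_ofReal_smul, shift, S.entry_coe,
          hd _ (IndexedMatrix.mem_critical_coe.2 a.2)]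
        rfl
      · intro b
        rw [untrop_ofReal_smul, shift, hd _ (IndexedMatrix.mem_critical_coe.2 b.2),
          S.entry_coe b.1 ⟨j, hj⟩]
        rfl
      · intro a b
        have := hu a.1.1 b.1.1
        rw [shift, S.entry_coe] at this
        rwa [value, untrop_ofReal_smul]

/-- Converse of `next_entry_le` up to an arbitrarily small slack; `exists_gap` later turns such
strict bounds into equalities. -/
theorem IndexedMatrix.exists_pathWeight_lt_of_next (S : IndexedMatrix V)
    (hd : ∀ v ∈ S.critical, d v = rhoMin S.mat) {x : ℝ}
    (hx : shift S.next.entry d i j < (x : WithTop ℝ)) :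
    ∃ s, pathWeight (shift S.entry d) (i :: s) j < (x : WithTop ℝ) := by
  obtain ⟨hi, hj⟩ := IndexedMatrix.mem_of_entry_ne_top (add_coe_ne_top_iff.1 hx.ne_top)
  obtain ⟨hi, hi'⟩ := IndexedMatrix.exists_of_mem_next_nodes hi
  obtain ⟨hj, hj'⟩ := IndexedMatrix.exists_of_mem_next_nodes hj
  rw [shift, S.next_entry hi hj hi' hj', ← min_add_add_right, min_lt_iff] at hx
  rcases hx with hx | hx
  · exact ⟨[], by simpa [shift] using hx⟩
  obtain ⟨a, ha⟩ := exists_untrop_mul_apply_eq (WithTop.add_ne_top.1 hx.ne_top).1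
  rw [ha] at hx
  obtain ⟨y, hy⟩ := WithTop.ne_top_iff_exists.1
    (WithTop.add_ne_top.1 (WithTop.add_ne_top.1 hx.ne_top).1).1
  rw [← hy] at hx
  have hy' : S.entry i a.1.1 = y :=
    (S.entry_coe ⟨i, hi⟩ a.1).trans hy.symm
  have hx' : ∀ z : WithTop ℝ, (y : WithTop ℝ) + z + ((-d i : ℝ) : WithTop ℝ) < x ↔
      z < ((x - y + d i : ℝ) : WithTop ℝ) := by
    intro z
    rcases eq_or_ne z ⊤ with ht | ht
    · simp [ht]
    · obtain ⟨z, rfl⟩ := WithTop.ne_top_iff_exists.1 ht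
      norm_cast
      constructor <;> intro <;> linarith
  rw [hx'] at hx
  obtain ⟨t, ht⟩ := exists_pathWeight_lt (f := shift S.entry d) (e := j)
    (g := fun x : {i : S.nodes // i ∈ criticalNodes S.mat} => x.1.1) (fun a b => by
      rw [value, untrop_ofReal_smul, shift, S.entry_coe,
          hd _ (IndexedMatrix.mem_critical_coe.2 a.2)]
      rfl) (fun b => by
      rw [untrop_ofReal_smul, shift, hd _ (IndexedMatrix.mem_critical_coe.2 b.2),
          S.entry_coe b.1 ⟨j, hj⟩]
      rfl) hx
  refine ⟨(a :: t).map fun x => x.1.1, ?_⟩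
  rw [pathWeight_cons, List.map_cons, List.headD_cons, shift, hy', add_right_comm, hx']
  exact ht

/-- Contraction of a path to its nodes outside of the critical ones. -/
theorem IndexedMatrix.Connected.pathWeight_filter_le (h : S.Connected)
    (hd : ∀ v ∈ S.critical, d v = rhoMin S.mat) (hj : j ∈ S.next.nodes) (l : List V) :
    ∀ (i : V) (s : List V), i ∈ S.next.nodes → (∀ v ∈ s, v ∈ S.critical) →
      pathWeight (shift S.next.entry d) (i :: l.filter (· ∈ S.next.nodes)) j ≤
        pathWeight (shift S.entry d) (i :: (s ++ l)) j := by
  induction l with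
  | nil =>
    intro i s hi hs
    rw [List.filter_nil, pathWeight_cons, pathWeight_nil, add_zero, List.append_nil]
    exact h.next_entry_le hd hi hj hs
  | cons a l ih =>
    intro i s hi hs
    by_cases ha : a ∈ S.next.nodes
    · rw [List.filter_cons_of_pos (by simpa using ha), pathWeight_cons, List.headD_cons,
        ← List.cons_append, pathWeight_append, List.headD_cons]
      exact add_le_add (h.next_entry_le hd hi ha hs) (ih a [] ha (by simp))
    · rw [List.filter_cons_of_neg (by simpa using ha)]
      by_cases hc : a ∈ S.critical
      -- The list `s` accumulates the critical nodes met since the last retained node `i`.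
      · have := ih i (s ++ [a]) hi (by
          simp only [List.mem_append, List.mem_singleton]
          rintro v (hv | rfl)
          exacts [hs v hv, hc])
        rwa [List.append_assoc, List.singleton_append] at this
      · have hn : a ∉ S.nodes := fun hn => ha (IndexedMatrix.mem_next_nodes.2 ⟨hn, hc⟩)
        have ht : shift S.entry d a (l.headD j) = ⊤ := by
          by_contra hne
          exact hn (IndexedMatrix.mem_of_entry_ne_top (add_coe_ne_top_iff.1 hne)).1
        rw [← List.cons_append, pathWeight_append, pathWeight_cons _ a, ht]
        simp

theorem IndexedMatrix.Connected.next (h : S.Connected) : S.next.Connected := by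
  refine ⟨fun i hi j hj => ?_, fun i j hij => IndexedMatrix.mem_of_entry_ne_top hij⟩
  obtain ⟨l, hl⟩ := h.1 i (IndexedMatrix.mem_next_nodes.1 hi).1 j
    (IndexedMatrix.mem_next_nodes.1 hj).1
  have := h.pathWeight_filter_le (d := fun _ => rhoMin S.mat) (fun _ _ => rfl) hj l i [] hi
    (by simp)
  rw [List.nil_append, pathWeight_shift, pathWeight_shift] at this
  refine ⟨l.filter (· ∈ S.next.nodes), fun ht => ?_⟩
  rw [ht, top_add, top_le_iff] at this
  exact add_coe_ne_top_iff.2 hl this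

/-- Contraction of a circuit that has a node outside of the critical ones. -/
theorem IndexedMatrix.Connected.exists_contraction (h : S.Connected)
    (hd : ∀ v ∈ S.critical, d v = rhoMin S.mat) {c : List V} (hi : i ∈ S.next.nodes)
    (hic : i ∈ c) : ∃ c', (∀ v, v ∈ c' ↔ v ∈ c ∧ v ∈ S.next.nodes) ∧
      circuitWeight (shift S.next.entry d) c' ≤ circuitWeight (shift S.entry d) c := by
  obtain ⟨l₁, l₂, rfl⟩ := List.append_of_mem hic
  refine ⟨i :: (l₂ ++ l₁).filter (· ∈ S.next.nodes), fun v => ?_, ?_⟩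
  · simp only [List.mem_cons, List.mem_filter, List.mem_append, decide_eq_true_eq]
    constructor
    · rintro (rfl | ⟨h | h, h'⟩) <;> simp [*]
    · tauto
  · rw [circuitWeight_append_comm, List.cons_append, circuitWeight_cons, circuitWeight_cons]
    exact h.pathWeight_filter_le hd hi _ i [] hi (by simp)

theorem IndexedMatrix.exists_path_lift (S : IndexedMatrix V)
    (hd : ∀ v ∈ S.critical, d v = rhoMin S.mat) (l : List V) (e : V) {x : ℝ}
    (hx : pathWeight (shift S.next.entry d) l e < (x : WithTop ℝ)) :
    ∃ l', l'.headD e = l.headD e ∧ l ⊆ l' ∧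
      pathWeight (shift S.entry d) l' e < (x : WithTop ℝ) := by
  induction l generalizing x with
  | nil => exact ⟨[], rfl, by simp, hx⟩
  | cons a l ih =>
    rw [pathWeight_cons] at hx
    obtain ⟨h1, h2⟩ := WithTop.add_ne_top.1 hx.ne_top
    obtain ⟨y, hy⟩ := WithTop.ne_top_iff_exists.1 h1
    obtain ⟨z, hz⟩ := WithTop.ne_top_iff_exists.1 h2
    rw [← hy, ← hz] at hx
    norm_cast at hx
    -- The slack `x - (y + z)` is halved between the first arc and the rest of the path.
    obtain ⟨l', hl', hsub, hlt⟩ := ih (x := (x - y + z) / 2) (by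
      rw [← hz]; norm_cast; linarith)
    obtain ⟨s, hs⟩ := S.exists_pathWeight_lt_of_next hd (x := (x + y - z) / 2) (by
      rw [← hy]; norm_cast; linarith)
    refine ⟨a :: s ++ l', rfl, ?_, ?_⟩
    · rw [List.cons_append]
      exact List.cons_subset_cons _ (List.Subset.trans hsub (List.subset_append_right _ _))
    · rw [pathWeight_append, hl']
      obtain ⟨y', hy'⟩ := WithTop.ne_top_iff_exists.1 hs.ne_top
      obtain ⟨z', hz'⟩ := WithTop.ne_top_iff_exists.1 hlt.ne_top
      rw [← hy'] at hs ⊢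
      rw [← hz'] at hlt ⊢
      norm_cast at hs hlt ⊢
      linarith

/-- A circuit of the Schur complement comes from circuits of the matrix. -/
theorem IndexedMatrix.exists_lift (S : IndexedMatrix V)
    (hd : ∀ v ∈ S.critical, d v = rhoMin S.mat) {c : List V} {x : ℝ}
    (hx : circuitWeight (shift S.next.entry d) c < (x : WithTop ℝ)) :
    ∃ c', c ⊆ c' ∧ circuitWeight (shift S.entry d) c' < (x : WithTop ℝ) := by
  cases c with
  | nil => exact ⟨[], by simp, hx⟩
  | cons a l =>
    rw [circuitWeight_cons] at hx
    obtain ⟨l', hl', hsub, hlt⟩ := S.exists_path_lift hd _ _ hx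
    refine ⟨l', hsub, ?_⟩
    cases l' with
    | nil => simp at hsub
    | cons b l' =>
      obtain rfl : b = a := by simpa using hl'
      rwa [circuitWeight_cons]

end Schur

/-! ### Strict increase of the minimal circuit mean -/

theorem circuitWeight_mono {V : Type*} {f g : V → V → WithTop ℝ} (h : ∀ i j, f i j ≤ g i j)
    (c : List V) : circuitWeight f c ≤ circuitWeight g c :=
  List.sum_le_sum fun _ _ => h _ _

theorem shift_congr {V : Type*} {f : V → V → WithTop ℝ} {d d' : V → ℝ} {c : List V}
    (h : ∀ i ∈ c, d i = d' i) : circuitWeight (shift f d) c = circuitWeight (shift f d') c :=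
  circuitWeight_congr fun i hi j _ => by rw [shift, shift, h i hi]

section

variable {V : Type*} [DecidableEq V] {S : IndexedMatrix V}

theorem IndexedMatrix.mem_critical_of_circuitWeight_eq_zero {c : List V}
    (h : circuitWeight (shift S.entry fun _ => rhoMin S.mat) c = 0) : ∀ v ∈ c, v ∈ S.critical :=
  fun _ hv => IndexedMatrix.mem_critical_iff.2 ⟨c, hv, h⟩

/-- If the mean did not increase, a critical circuit of the Schur complement would lift to circuits
of weight below every `ε > 0`, even after subtraction of the larger constant `rhoMin S.mat`. By the
gap such a lift has weight zero for small `ε`, so it is critical, yet it passes through a node that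
is not. -/
theorem IndexedMatrix.Connected.rhoMin_lt [Finite V] (h : S.Connected)
    (hne : S.next.nodes.Nonempty) : rhoMin S.mat < rhoMin S.next.mat := by
  by_contra! hle
  obtain ⟨v, hv⟩ := h.next.critical_nonempty hne
  obtain ⟨c, hvc, hc⟩ := IndexedMatrix.mem_critical_iff.1 hv
  have hN := IndexedMatrix.mem_of_circuitWeight_ne_top (S := S.next) (hc ▸ WithTop.zero_ne_top)
  let d : V → ℝ := fun i => if i ∈ S.critical then rhoMin S.mat else rhoMin S.next.mat
  obtain ⟨u, hu⟩ := h.exists_potential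
  obtain ⟨ε, hε, hgap⟩ := hu.exists_gap
  obtain ⟨c', hcc', hc'⟩ := S.exists_lift (d := d) (fun v hv => if_pos hv) (c := c) (x := ε) (by
    rw [shift_congr (d' := fun _ => rhoMin S.next.mat) fun i hi =>
      if_neg (IndexedMatrix.mem_next_nodes.1 (hN i hi)).2, hc]
    exact_mod_cast hε)
  have h0 := hgap c' (lt_of_le_of_lt (circuitWeight_mono (fun i j => by
    refine add_le_add_right (WithTop.coe_le_coe.2 (neg_le_neg ?_)) _
    simp only [d]
    split_ifs
    exacts [le_rfl, hle]) c') hc')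
  exact (IndexedMatrix.mem_next_nodes.1 (hN v hvc)).2
    (IndexedMatrix.mem_critical_of_circuitWeight_eq_zero h0 v (hcc' hvc))

end

/-! ### The chain of Schur complements and the critical graphs -/

section Chain

variable {V : Type*} [Fintype V] [DecidableEq V] {A : Matrix V V Rmin}

theorem reduced_succ {t : ℕ} (ht : 1 ≤ t) : reduced A (t + 1) = (reduced A t).next := by
  obtain ⟨t, rfl⟩ := Nat.exists_eq_add_of_le' ht
  rfl

theorem entry_reduced_one : (reduced A 1).entry = value A := by
  ext i j
  exact (reduced A 1).entry_coe ⟨i, Finset.mem_univ i⟩ ⟨j, Finset.mem_univ j⟩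

theorem connected_reduced_one (hA : IsIrreducible A) : (reduced A 1).Connected := by
  refine ⟨fun i _ j _ => ?_, fun i j h => IndexedMatrix.mem_of_entry_ne_top h⟩
  rw [entry_reduced_one]
  induction hA i j using Relation.TransGen.head_induction_on with
  | single h => exact ⟨[], by simpa using value_ne_top_iff.2 h⟩
  | @head a b h _ ih =>
    obtain ⟨l, hl⟩ := ih (Finset.mem_univ _)
    refine ⟨b :: l, ?_⟩
    rw [pathWeight_cons, List.headD_cons]
    exact WithTop.add_ne_top.2 ⟨value_ne_top_iff.2 h, hl⟩

theorem connected_reduced (hA : IsIrreducible A) {t : ℕ} (ht : 1 ≤ t) :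
    (reduced A t).Connected := by
  induction t, ht using Nat.le_induction with
  | base => exact connected_reduced_one hA
  | succ t ht ih => rw [reduced_succ ht]; exact ih.next

theorem mem_nodes_reduced {t : ℕ} (ht : 1 ≤ t) {v : V} :
    v ∈ (reduced A t).nodes ↔ ∀ m ∈ Finset.Ico 1 t, v ∉ critSet A m := by
  induction t, ht using Nat.le_induction with
  | base => simp [reduced]
  | succ t ht ih =>
    rw [reduced_succ ht, IndexedMatrix.mem_next_nodes, ih,
      ← Finset.insert_Ico_right_eq_Ico_add_one ht, Finset.forall_mem_insert, and_comm]
    rfl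

theorem critSet_subset_nodes (t : ℕ) : critSet A t ⊆ (reduced A t).nodes :=
  (reduced A t).critical_subset

theorem notMem_critSet_of_lt {m t : ℕ} (hm : 1 ≤ m) (hmt : m < t) {v : V}
    (hv : v ∈ critSet A t) : v ∉ critSet A m :=
  (mem_nodes_reduced (hm.trans hmt.le)).1 (critSet_subset_nodes t hv) m
    (Finset.mem_Ico.2 ⟨hm, hmt⟩)

theorem disjoint_critSet {m t : ℕ} (hm : 1 ≤ m) (hmt : m < t) :
    Disjoint (critSet A m) (critSet A t) :=
  Finset.disjoint_right.2 fun _ hv => notMem_critSet_of_lt hm hmt hv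

/-- The vector equal to `α_m` on `C_m` for `m < ℓ`, and to `α_ℓ` elsewhere. -/
def level (A : Matrix V V Rmin) (l : ℕ) (i : V) : ℝ :=
  alpha A l + ∑ m ∈ Finset.Ico 1 l, if i ∈ critSet A m then alpha A m - alpha A l else 0

theorem level_of_mem_nodes {l : ℕ} (hl : 1 ≤ l) {i : V} (hi : i ∈ (reduced A l).nodes) :
    level A l i = alpha A l := by
  rw [level, Finset.sum_eq_zero fun m hm => if_neg ((mem_nodes_reduced hl).1 hi m hm), add_zero]

theorem level_of_mem_critSet {m l : ℕ} (hm : 1 ≤ m) (hml : m ≤ l) {i : V}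
    (hi : i ∈ critSet A m) : level A l i = alpha A m := by
  rcases hml.eq_or_lt with rfl | hlt
  · exact level_of_mem_nodes hm (critSet_subset_nodes _ hi)
  · rw [level, Finset.sum_eq_single_of_mem m (Finset.mem_Ico.2 ⟨hm, hlt⟩), if_pos hi,
      add_sub_cancel]
    intro b hb hbm
    rw [if_neg]
    intro hib
    rcases lt_or_gt_of_ne hbm with h | h
    · exact notMem_critSet_of_lt (Finset.mem_Ico.1 hb).1 h hi hib
    · exact notMem_critSet_of_lt hm h hib hi

/-- With `level` written as a sum of indicators the identity is additive in the nodes of `c`, and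
disjointness of the `C_m` plays no role. -/
theorem sum_map_level (l : ℕ) (c : List V) :
    (c.map (level A l)).sum =
      ∑ m ∈ Finset.Ico 1 l, alpha A m * countIn (critSet A m) c +
        alpha A l * lengthOfOrder A l c := by
  induction c with
  | nil => simp [lengthOfOrder, countIn]
  | cons a c ih =>
    have h : ∀ m, (countIn (critSet A m) (a :: c) : ℝ) =
        countIn (critSet A m) c + if a ∈ critSet A m then 1 else 0 := fun m => by
      rw [countIn, List.countP_cons, countIn]
      push_cast
      simp
    rw [List.map_cons, List.sum_cons, ih]
    simp only [lengthOfOrder, h, level, List.length_cons, mul_add, Finset.sum_add_distrib,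
      mul_sub, Finset.mul_sum, mul_ite, mul_one, mul_zero]
    have : ∀ m, (if a ∈ critSet A m then alpha A m - alpha A l else 0) =
        (if a ∈ critSet A m then alpha A m else 0) - if a ∈ critSet A m then alpha A l else 0 :=
      fun m => by split_ifs <;> simp
    simp only [this, Finset.sum_sub_distrib]
    push_cast
    ring

theorem isCriticalOfOrder_iff {l : ℕ} {c : List V} :
    IsCriticalOfOrder A l c ↔ c ≠ [] ∧ circuitWeight (shift (value A) (level A l)) c = 0 := by
  rw [IsCriticalOfOrder, isCircuit_iff, circuitWeight_shift, and_assoc, sum_map_level,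
    weightOfOrder]
  refine and_congr_right fun _ => ?_
  rcases eq_or_ne (circuitWeight (value A) c) ⊤ with ht | ht
  · simp [ht]
  · rw [circuitWeight_value ht]
    norm_cast
    simp only [WithTop.coe_ne_top, not_false_eq_true, true_and]
    constructor <;> intro h <;> linarith

/-- Descending induction on `t`. On `A_l` the level is the constant `α_l`, the minimal mean. On
`A_t` a circuit either stays in `C_t`, where the level is `α_t`, or contracts to a circuit of
`A_{t+1}` that is no heavier and keeps all its nodes outside `C_t`. -/
theorem circuitWeight_level_aux (hA : IsIrreducible A) {l t : ℕ} (ht : 1 ≤ t) (htl : t ≤ l)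
    (c : List V) :
    0 ≤ circuitWeight (shift (reduced A t).entry (level A l)) c ∧
      (circuitWeight (shift (reduced A t).entry (level A l)) c = 0 →
        ∀ v ∈ c, ∃ m, 1 ≤ m ∧ m ≤ l ∧ v ∈ critSet A m) := by
  induction htl using Nat.decreasingInduction generalizing c with
  | self =>
    rcases eq_or_ne (circuitWeight (shift (reduced A l).entry (level A l)) c) ⊤ with hc | hc
    · simp [hc]
    rw [shift_congr fun i hi =>
      level_of_mem_nodes ht (IndexedMatrix.mem_of_circuitWeight_ne_top hc i hi)]
    exact ⟨(reduced A l).rhoMin_le c, fun h v hv =>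
      ⟨l, ht, le_rfl, IndexedMatrix.mem_critical_of_circuitWeight_eq_zero h v hv⟩⟩
  | of_succ t htl ih =>
    rcases eq_or_ne (circuitWeight (shift (reduced A t).entry (level A l)) c) ⊤ with hc | hc
    · simp [hc]
    have hN := IndexedMatrix.mem_of_circuitWeight_ne_top hc
    have hd : ∀ v ∈ (reduced A t).critical, level A l v = rhoMin (reduced A t).mat :=
      fun v hv => level_of_mem_critSet ht (Nat.le_of_lt htl) hv
    by_cases hi : ∃ i ∈ c, i ∈ (reduced A t).next.nodes
    · obtain ⟨i, hic, hi⟩ := hi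
      obtain ⟨c', hmem, hle⟩ := (connected_reduced hA ht).exists_contraction hd hi hic
      have := ih (by omega) c'
      rw [reduced_succ ht] at this
      refine ⟨this.1.trans hle, fun h0 v hv => ?_⟩
      by_cases hvc : v ∈ (reduced A t).critical
      · exact ⟨t, ht, Nat.le_of_lt htl, hvc⟩
      · exact this.2 (le_antisymm (hle.trans h0.le) this.1) v
          ((hmem v).2 ⟨hv, IndexedMatrix.mem_next_nodes.2 ⟨hN v hv, hvc⟩⟩)
    · have hC : ∀ v ∈ c, v ∈ (reduced A t).critical := by
        intro v hv
        by_contra hvc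
        exact hi ⟨v, hv, IndexedMatrix.mem_next_nodes.2 ⟨hN v hv, hvc⟩⟩
      rw [shift_congr fun i hi => hd i (hC i hi)]
      exact ⟨(reduced A t).rhoMin_le c, fun _ v hv => ⟨t, ht, Nat.le_of_lt htl, hC v hv⟩⟩

theorem exists_potential_level (hA : IsIrreducible A) {l : ℕ} (hl : 1 ≤ l) :
    ∃ u, IsPotential (shift (value A) (level A l)) u := by
  have h := connected_reduced_one hA
  rw [IndexedMatrix.Connected, entry_reduced_one] at h
  refine ConnectedOn.exists_potential (ConnectedOn.shift h _) fun c => ?_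
  have := (circuitWeight_level_aux hA le_rfl hl c).1
  rwa [entry_reduced_one] at this

theorem exists_mem_critSet (hA : IsIrreducible A) {l : ℕ} (hl : 1 ≤ l) {c : List V}
    (hc : circuitWeight (shift (value A) (level A l)) c = 0) {v : V} (hv : v ∈ c) :
    ∃ m, 1 ≤ m ∧ m ≤ l ∧ v ∈ critSet A m := by
  have := (circuitWeight_level_aux hA le_rfl hl c).2
  rw [entry_reduced_one] at this
  exact this hc v hv

theorem exists_lift_reduced {l t : ℕ} (ht : 1 ≤ t) (htl : t ≤ l) {c : List V} {x : ℝ}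
    (hx : circuitWeight (shift (reduced A t).entry (level A l)) c < (x : WithTop ℝ)) :
    ∃ c', c ⊆ c' ∧ circuitWeight (shift (value A) (level A l)) c' < (x : WithTop ℝ) := by
  induction t, ht using Nat.le_induction generalizing c with
  | base => rw [entry_reduced_one] at hx; exact ⟨c, List.Subset.refl c, hx⟩
  | succ t ht ih =>
    rw [reduced_succ ht] at hx
    obtain ⟨c₁, h₁, hw⟩ := (reduced A t).exists_lift
      (fun v hv => level_of_mem_critSet ht (by omega) hv) hx
    obtain ⟨c₂, h₂, hw₂⟩ := ih (by omega) hw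
    exact ⟨c₂, List.Subset.trans h₁ h₂, hw₂⟩

/-- On the circuits that are critical of order `m`, the levels of order `l ≥ m` agree with those
of order `m`. -/
theorem circuitWeight_level_mono (hA : IsIrreducible A) {m l : ℕ} (hm : 1 ≤ m) (hml : m ≤ l)
    {c : List V} (hc : circuitWeight (shift (value A) (level A m)) c = 0) :
    circuitWeight (shift (value A) (level A l)) c = 0 := by
  rw [← hc]
  refine shift_congr fun i hi => ?_
  obtain ⟨r, hr, hrm, hir⟩ := exists_mem_critSet hA hm hc hi
  rw [level_of_mem_critSet hr (hrm.trans hml) hir, level_of_mem_critSet hr hrm hir]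

/-- A critical circuit of `A_m` lifts to circuits of `A` of reduced weight below any `ε > 0`, and
the gap makes that weight zero for a suitable `ε`. -/
theorem exists_circuit_of_mem_critSet (hA : IsIrreducible A) {m l : ℕ} (hm : 1 ≤ m) (hml : m ≤ l)
    {v : V} (hv : v ∈ critSet A m) :
    ∃ c, v ∈ c ∧ circuitWeight (shift (value A) (level A l)) c = 0 := by
  obtain ⟨c, hvc, hc⟩ := IndexedMatrix.mem_critical_iff.1 hv
  have hN := IndexedMatrix.mem_of_circuitWeight_ne_top (S := reduced A m)
    (hc ▸ WithTop.zero_ne_top)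
  change circuitWeight (shift (reduced A m).entry fun _ => alpha A m) c = 0 at hc
  rw [← shift_congr fun i hi => level_of_mem_nodes hm (hN i hi)] at hc
  obtain ⟨u, hu⟩ := exists_potential_level hA hm
  obtain ⟨ε, hε, hgap⟩ := hu.exists_gap
  obtain ⟨c', hcc', hc'⟩ := exists_lift_reduced hm le_rfl (x := ε)
    (by rw [hc]; exact_mod_cast hε)
  exact ⟨c', hcc' hvc, circuitWeight_level_mono hA hm hml (hgap c' hc')⟩

/-- An empty index set would mean that `C_1 ∪ ⋯ ∪ C_{t-1}` is everything, against the minimality of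
`k`. -/
theorem nodes_reduced_nonempty {t : ℕ} (ht : 1 ≤ t) (htk : t ≤ numCriticalValues A) :
    (reduced A t).nodes.Nonempty := by
  by_contra hne
  rw [Finset.not_nonempty_iff_eq_empty] at hne
  refine Nat.notMem_of_lt_sInf (m := t - 1) (lt_of_lt_of_le (by omega) htk) ?_
  refine Finset.eq_univ_iff_forall.2 fun v => ?_
  by_contra hv
  have : v ∈ (reduced A t).nodes := by
    refine (mem_nodes_reduced ht).2 fun m hm hvm => hv (Finset.mem_biUnion.2 ⟨m, ?_, hvm⟩)
    rw [Finset.mem_Ico] at hm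
    rw [Finset.mem_Icc]
    omega
  simp [hne] at this

theorem critSet_nonempty (hA : IsIrreducible A) {t : ℕ} (ht : 1 ≤ t)
    (htk : t ≤ numCriticalValues A) : (critSet A t).Nonempty :=
  (connected_reduced hA ht).critical_nonempty (nodes_reduced_nonempty ht htk)

theorem alpha_lt_alpha (hA : IsIrreducible A) {m l : ℕ} (hm : 1 ≤ m) (hml : m < l)
    (hlk : l ≤ numCriticalValues A) : alpha A m < alpha A l := by
  induction l, hml using Nat.le_induction with
  | base =>
    have := nodes_reduced_nonempty (by omega) hlk
    rw [reduced_succ hm] at this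
    rw [alpha, alpha, reduced_succ hm]
    exact (connected_reduced hA hm).rhoMin_lt this
  | succ l hl ih =>
    refine (ih (by omega)).trans ?_
    have := nodes_reduced_nonempty (by omega) hlk
    rw [reduced_succ (by omega)] at this
    rw [alpha, alpha, reduced_succ (by omega)]
    exact (connected_reduced hA (by omega)).rhoMin_lt this

/-- The nodes of `C_1 ∪ ⋯ ∪ C_l`. -/
def critUnion (A : Matrix V V Rmin) (l : ℕ) : Finset V := (Finset.Icc 1 l).biUnion (critSet A)

theorem mem_critUnion {l : ℕ} {v : V} :
    v ∈ critUnion A l ↔ ∃ m, 1 ≤ m ∧ m ≤ l ∧ v ∈ critSet A m := by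
  simp [critUnion, and_assoc]

theorem level_lt_or_eq (hA : IsIrreducible A) {l : ℕ} (hl : 1 ≤ l)
    (hlk : l ≤ numCriticalValues A) (i : V) :
    (i ∈ critUnion A (l - 1) ∧ level A l i < alpha A l) ∨
      (i ∉ critUnion A (l - 1) ∧ level A l i = alpha A l) := by
  by_cases hi : i ∈ critUnion A (l - 1)
  · obtain ⟨m, hm, hml, him⟩ := mem_critUnion.1 hi
    refine Or.inl ⟨hi, ?_⟩
    rw [level_of_mem_critSet hm (by omega) him]
    exact alpha_lt_alpha hA hm (by omega) hlk
  · refine Or.inr ⟨hi, level_of_mem_nodes hl ((mem_nodes_reduced hl).2 fun m hm him => hi ?_)⟩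
    rw [Finset.mem_Ico] at hm
    exact mem_critUnion.2 ⟨m, hm.1, by omega, him⟩

theorem card_critUnion {l : ℕ} (hl : 1 ≤ l) :
    (critUnion A l).card = (critUnion A (l - 1)).card + (critSet A l).card := by
  obtain ⟨l, rfl⟩ := Nat.exists_eq_add_of_le' hl
  rw [Nat.add_sub_cancel, ← Finset.card_union_of_disjoint]
  · congr 1
    ext v
    rw [Finset.mem_union, mem_critUnion, mem_critUnion]
    constructor
    · rintro ⟨m, hm, hml, hv⟩
      rcases hml.eq_or_lt with rfl | h
      · exact Or.inr hv
      · exact Or.inl ⟨m, hm, by omega, hv⟩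
    · rintro (⟨m, hm, hml, hv⟩ | hv)
      · exact ⟨m, hm, by omega, hv⟩
      · exact ⟨l + 1, hl, le_rfl, hv⟩
  · refine Finset.disjoint_left.2 fun v hv => ?_
    obtain ⟨m, hm, hml, hv⟩ := mem_critUnion.1 hv
    exact Finset.disjoint_left.1 (disjoint_critSet hm (by omega)) hv

theorem mem_nodes_critGraph (hA : IsIrreducible A) {l : ℕ} {v : V} :
    v ∈ (critGraph A l).nodes ↔ v ∈ critUnion A l := by
  rw [mem_critUnion]
  cases l with
  | zero => simp only [critGraph, Set.mem_empty_iff_false, false_iff]; rintro ⟨m, h, h', -⟩; omega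
  | succ l =>
    constructor
    · rintro ⟨c, hc, hv⟩
      exact exists_mem_critSet hA (by omega) (isCriticalOfOrder_iff.1 hc).2 hv
    · rintro ⟨m, hm, hml, hv⟩
      obtain ⟨c, hvc, hc⟩ := exists_circuit_of_mem_critSet hA hm hml hv
      exact ⟨c, isCriticalOfOrder_iff.2 ⟨List.ne_nil_of_mem hvc, hc⟩, hvc⟩

/-- The arcs of the critical graphs of order at most `l` are saturated by the potentials of
order `l`. -/
theorem saturated_of_mem_arcs_critGraph (hA : IsIrreducible A) {m l : ℕ} (hml : m ≤ l) {u : V → ℝ}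
    (hu : IsPotential (shift (value A) (level A l)) u) {a : V × V}
    (ha : a ∈ (critGraph A m).arcs) :
    shift (value A) (level A l) a.1 a.2 + (u a.2 : WithTop ℝ) = (u a.1 : WithTop ℝ) := by
  cases m with
  | zero => exact absurd ha (Set.notMem_empty a)
  | succ m =>
    obtain ⟨c, hc, hac⟩ := ha
    exact hu.saturated_of_circuitWeight_nonpos
      (circuitWeight_level_mono hA (by omega) hml (isCriticalOfOrder_iff.1 hc).2).le a hac

end Chain

/-! ### Arithmetic and order of min-plus scalars -/

section Scalars

theorem ofReal_inj {x y : ℝ} : ofReal x = ofReal y ↔ x = y := by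
  rw [ofReal, ofReal, Tropical.trop_inj_iff, WithTop.coe_inj]

theorem ofReal_mul (x y : ℝ) : ofReal x * ofReal y = ofReal (x + y) := rfl

theorem ofReal_pow (x : ℝ) (n : ℕ) : ofReal x ^ n = ofReal (n * x) := by
  rw [ofReal, ← Tropical.trop_nsmul, ← WithTop.coe_nsmul, nsmul_eq_mul, ofReal]

theorem ofReal_le {x y : ℝ} : ofReal x ≤ ofReal y ↔ x ≤ y := by
  exact Tropical.untrop_le_iff.symm.trans WithTop.coe_le_coe

theorem ofReal_ne_zero (x : ℝ) : ofReal x ≠ 0 := by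
  rw [ofReal, Ne, ← Tropical.untrop_inj_iff]
  exact WithTop.coe_ne_top

theorem exists_ofReal {x : Rmin} (h : x ≠ 0) : ∃ r, x = ofReal r := by
  obtain ⟨r, hr⟩ := WithTop.ne_top_iff_exists.1
    (show Tropical.untrop x ≠ ⊤ from fun h' => h (Tropical.untrop_injective h'))
  exact ⟨r, Tropical.untrop_injective hr.symm⟩

theorem ofReal_add_of_le {x y : ℝ} (h : x ≤ y) : ofReal x + ofReal y = ofReal x :=
  Tropical.add_eq_left (ofReal_le.2 h)

theorem ofReal_add_of_ge {x y : ℝ} (h : y ≤ x) : ofReal x + ofReal y = ofReal y :=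
  Tropical.add_eq_right (ofReal_le.2 h)

theorem sum_le_apply {ι : Type*} {s : Finset ι} (f : ι → Rmin) {i : ι} (hi : i ∈ s) :
    ∑ j ∈ s, f j ≤ f i := by
  rw [← Tropical.untrop_le_iff, Finset.untrop_sum']
  exact Finset.inf_le (f := Tropical.untrop ∘ f) hi

theorem le_sum {ι : Type*} {s : Finset ι} {f : ι → Rmin} {x : Rmin} (h : ∀ i ∈ s, x ≤ f i) :
    x ≤ ∑ j ∈ s, f j := by
  rw [← Tropical.untrop_le_iff, Finset.untrop_sum']
  exact Finset.le_inf fun i hi => Tropical.untrop_le_iff.2 (h i hi)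

theorem sum_eq_apply {ι : Type*} {s : Finset ι} {f : ι → Rmin} {i : ι} (hi : i ∈ s)
    (h : ∀ j ∈ s, f i ≤ f j) : ∑ j ∈ s, f j = f i :=
  le_antisymm (sum_le_apply f hi) (le_sum h)

theorem mul_left_cancel_ofReal {r : ℝ} {x y : Rmin} (h : ofReal r * x = ofReal r * y) : x = y := by
  have := congrArg (ofReal (-r) * ·) h
  simp only [← mul_assoc, ofReal_mul, neg_add_cancel] at this
  have h1 : ofReal 0 = 1 := rfl
  simpa [h1] using this

end Scalars

/-! ### Existence of the roots of a min-plus polynomial -/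

section Factorization

/-- A min-plus polynomial function is a product of linear factors. -/
theorem exists_factorization (n : ℕ) :
    ∀ (p : ℕ → Rmin) (q : ℝ), p n = ofReal q → ∃ c : Multiset Rmin, c.card = n ∧
      ∀ y : Rmin, ∑ j ∈ Finset.range (n + 1), p j * y ^ j =
        ofReal q * (c.map fun r => y + r).prod := by
  induction n using Nat.strong_induction_on with
  | _ n ih =>
    intro p q hq
    by_cases htop : ∀ j < n, p j = 0
    · refine ⟨Multiset.replicate n 0, by simp, fun y => ?_⟩
      rw [Finset.sum_range_succ, Finset.sum_eq_zero fun j hj => by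
        rw [htop j (Finset.mem_range.1 hj), zero_mul]]
      simp [hq]
    push Not at htop
    obtain ⟨j₁, hj₁, hpj₁⟩ := htop
    choose! x hx using fun j (hj : p j ≠ 0) => exists_ofReal hj
    -- The monomials of degrees `j` and `n` agree at `y = (x j - q) / (n - j)`. The least such point
    -- `z` is the smallest root: the leading monomial attains the minimum for `y ≤ z`, and the
    -- degrees up to `j₀` suffice for `y ≥ z`.
    obtain ⟨j₀, hj₀, hmin⟩ := Finset.exists_min_image
      ((Finset.range n).filter fun j => p j ≠ 0) (fun j => (x j - q) / ((n : ℝ) - j))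
      ⟨j₁, by simp [hj₁, hpj₁]⟩
    simp only [Finset.mem_filter, Finset.mem_range] at hj₀ hmin
    obtain ⟨hj₀n, hp₀⟩ := hj₀
    obtain ⟨z, hz⟩ : ∃ z, z = (x j₀ - q) / ((n : ℝ) - j₀) := ⟨_, rfl⟩
    have hn₀ : (0 : ℝ) < (n : ℝ) - j₀ := sub_pos.2 (by exact_mod_cast hj₀n)
    have hx₀ : x j₀ = q + (n - j₀) * z := by rw [hz]; field_simp; ring
    have hxj : ∀ j ≤ n, p j ≠ 0 → q + (n - j) * z ≤ x j := by
      intro j hj hpj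
      rcases hj.eq_or_lt with rfl | hjn
      · have : x j = q := ofReal_inj.1 ((hx j hpj).symm.trans hq)
        simp [this]
      · have h := hmin j ⟨hjn, hpj⟩
        rw [← hz, le_div_iff₀ (sub_pos.2 (by exact_mod_cast hjn))] at h
        linarith
    have hterm : ∀ j t, p j ≠ 0 → p j * ofReal t ^ j = ofReal (x j + j * t) := by
      intro j t hj
      rw [hx j hj, ofReal_pow, ofReal_mul]
    obtain ⟨c', hc', hfac⟩ := ih j₀ hj₀n p (x j₀) (hx j₀ hp₀)
    refine ⟨c' + Multiset.replicate (n - j₀) (ofReal z), by simp [hc']; omega, fun y => ?_⟩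
    rw [Multiset.map_add, Multiset.prod_add, Multiset.map_replicate, Multiset.prod_replicate]
    have hpn : p n ≠ 0 := hq ▸ ofReal_ne_zero q
    have hxn : x n = q := ofReal_inj.1 ((hx n hpn).symm.trans hq)
    have hcast : ((n - j₀ : ℕ) : ℝ) = n - j₀ := by rw [Nat.cast_sub hj₀n.le]
    by_cases hy : y ≠ 0 ∧ y ≤ ofReal z
    · obtain ⟨hy0, hyz⟩ := hy
      obtain ⟨t, rfl⟩ := exists_ofReal hy0
      rw [ofReal_le] at hyz
      -- Below `z` the monomial of degree `j₀` is the least among those of degree at most `j₀`,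
      -- which determines the product over `c'`.
      have hprod : (c'.map fun r => ofReal t + r).prod = ofReal (j₀ * t) := by
        apply mul_left_cancel_ofReal (r := x j₀)
        rw [← hfac, ofReal_mul, sum_eq_apply (i := j₀) (by simp), hterm _ _ hp₀]
        intro j hj
        rcases eq_or_ne (p j) 0 with h0 | h0
        · simp [h0]
        · rw [Finset.mem_range, Nat.lt_succ_iff] at hj
          have hj' : (0 : ℝ) ≤ (j₀ : ℝ) - j := sub_nonneg.2 (by exact_mod_cast hj)
          rw [hterm _ _ hp₀, hterm _ _ h0, ofReal_le]
          nlinarith [hxj j (by omega) h0, mul_nonneg hj' (sub_nonneg.2 hyz)]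
      rw [hprod, ofReal_add_of_le hyz, ofReal_pow, ofReal_mul, ofReal_mul,
        sum_eq_apply (i := n) (by simp), hterm _ _ hpn, ofReal_inj, hxn, hcast]
      · ring
      · intro j hj
        rcases eq_or_ne (p j) 0 with h0 | h0
        · simp [h0]
        · rw [Finset.mem_range, Nat.lt_succ_iff] at hj
          have hj' : (0 : ℝ) ≤ (n : ℝ) - j := sub_nonneg.2 (by exact_mod_cast hj)
          rw [hterm _ _ hpn, hterm _ _ h0, ofReal_le, hxn]
          nlinarith [hxj j hj h0, mul_nonneg hj' (sub_nonneg.2 hyz)]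
    · have hyz : y + ofReal z = ofReal z := by
        rw [Tropical.add_eq_right]
        by_cases h0 : y = 0
        · rw [h0]; exact Tropical.le_zero _
        · exact (not_le.1 fun h => hy ⟨h0, h⟩).le
      have hsum : ∑ j ∈ Finset.range (n + 1), p j * y ^ j =
          ∑ j ∈ Finset.range (j₀ + 1), p j * y ^ j := by
        refine le_antisymm (le_sum fun j hj => sum_le_apply (fun j => p j * y ^ j) ?_)
          (le_sum fun j hj => ?_)
        · rw [Finset.mem_range] at hj ⊢; omega
        · rw [Finset.mem_range, Nat.lt_succ_iff] at hj
          rcases le_or_gt j j₀ with hle | hgt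
          · exact sum_le_apply (fun j => p j * y ^ j) (Finset.mem_range.2 (by omega))
          · refine (sum_le_apply (fun j => p j * y ^ j)
              (Finset.mem_range.2 (Nat.lt_succ_self j₀))).trans ?_
            rcases eq_or_ne (p j) 0 with h0 | h0
            · simp [h0]
            rcases eq_or_ne y 0 with hy0 | hy0
            · rw [hy0, zero_pow (by omega : j ≠ 0), mul_zero]; exact Tropical.le_zero _
            obtain ⟨t, rfl⟩ := exists_ofReal hy0
            have htz : z ≤ t := by
              by_contra h
              exact hy ⟨hy0, ofReal_le.2 (not_le.1 h).le⟩
            have hj' : (0 : ℝ) ≤ (j : ℝ) - j₀ := sub_nonneg.2 (by exact_mod_cast hgt.le)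
            rw [hterm _ _ hp₀, hterm _ _ h0, ofReal_le]
            nlinarith [hxj j hj h0, mul_nonneg hj' (sub_nonneg.2 htz)]
      rw [hsum, hfac, hyz, ofReal_pow, hcast, hx₀, ← ofReal_mul]
      ring

theorem exists_isRootMultiset {P : Rmin[X]} (hP : P ≠ 0) : ∃ c, IsRootMultiset P c := by
  obtain ⟨q, hq⟩ := exists_ofReal (Polynomial.leadingCoeff_ne_zero.2 hP)
  obtain ⟨c, hc, h⟩ := exists_factorization P.natDegree P.coeff q hq
  exact ⟨c, hc, fun y => by rw [Polynomial.eval_eq_sum_range, h, hq]⟩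

end Factorization

/-! ### Multiplicity as a jump of slope -/

section Multiplicity

open Filter Topology

/-- Here `k` is the slope of `y ↦ y ⊕ r` to the right of `a`. The slope to the left is the same
unless `r = a`, when it is larger by one. -/
theorem eventually_factor (a : ℝ) (r : Rmin) : ∃ (w : ℝ) (k : ℕ), ofReal a + r = ofReal w ∧
    ∀ᶠ ε : ℝ in 𝓝[>] 0, ofReal (a + ε) + r = ofReal (w + ε * k) ∧
      ofReal (a - ε) + r = ofReal (w - ε * (k + if ofReal a = r then 1 else 0 : ℕ)) := by
  have hpos : ∀ᶠ ε : ℝ in 𝓝[>] 0, 0 < ε := self_mem_nhdsWithin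
  have hsmall : ∀ δ : ℝ, 0 < δ → ∀ᶠ ε : ℝ in 𝓝[>] 0, ε < δ :=
    fun δ hδ => nhdsWithin_le_nhds (Iio_mem_nhds hδ)
  rcases eq_or_ne r 0 with rfl | hr
  · refine ⟨a, 1, by simp, .of_forall fun ε => ?_⟩
    simp [ofReal_ne_zero]
  obtain ⟨x, rfl⟩ := exists_ofReal hr
  rcases lt_trichotomy a x with h | rfl | h
  · refine ⟨a, 1, ofReal_add_of_le h.le, ?_⟩
    filter_upwards [hpos, hsmall (x - a) (sub_pos.2 h)] with ε h1 h2
    rw [ofReal_add_of_le (by linarith), ofReal_add_of_le (by linarith),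
      if_neg (by rw [ofReal_inj]; exact h.ne)]
    simp
  · refine ⟨a, 0, ofReal_add_of_le le_rfl, ?_⟩
    filter_upwards [hpos] with ε h1
    rw [ofReal_add_of_ge (by linarith), ofReal_add_of_le (by linarith), if_pos rfl]
    simp
  · refine ⟨x, 0, ofReal_add_of_ge h.le, ?_⟩
    filter_upwards [hpos, hsmall (a - x) (sub_pos.2 h)] with ε h1 h2
    rw [ofReal_add_of_ge (by linarith), ofReal_add_of_ge (by linarith),
      if_neg (by rw [ofReal_inj]; exact h.ne')]
    simp

theorem eventually_prod (a : ℝ) (c : Multiset Rmin) : ∃ (w : ℝ) (k : ℕ),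
    (c.map fun r => ofReal a + r).prod = ofReal w ∧
    ∀ᶠ ε : ℝ in 𝓝[>] 0, (c.map fun r => ofReal (a + ε) + r).prod = ofReal (w + ε * k) ∧
      (c.map fun r => ofReal (a - ε) + r).prod =
        ofReal (w - ε * (k + c.count (ofReal a) : ℕ)) := by
  induction c using Multiset.induction_on with
  | empty => exact ⟨0, 0, rfl, .of_forall fun ε => by simp; rfl⟩
  | cons r c ih =>
    obtain ⟨w, k, h0, h⟩ := ih
    obtain ⟨w', k', h0', h'⟩ := eventually_factor a r
    refine ⟨w' + w, k' + k, by rw [Multiset.map_cons, Multiset.prod_cons, h0, h0', ofReal_mul], ?_⟩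
    filter_upwards [h, h'] with ε ⟨h1, h2⟩ ⟨h1', h2'⟩
    simp only [Multiset.map_cons, Multiset.prod_cons, h1, h2, h1', h2', ofReal_mul, ofReal_inj,
      Multiset.count_cons]
    push_cast
    constructor <;> ring

/-- Used with `σ = 0, 1, -1` for the value at `a` and the behaviour on either side. Monomials above
`v` at `a` stay above nearby by continuity; among those equal to `v`, the degree minimizing `σ * n
i` wins. -/
theorem eventually_sum {ι : Type*} (s : Finset ι) (p : ι → Rmin) (n : ι → ℕ) {a v σ : ℝ} {m : ℕ}
    (hle : ∀ i ∈ s, ∀ x, p i = ofReal x → v ≤ x + n i * a ∧ (v = x + n i * a → σ * m ≤ σ * n i))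
    (hm : ∃ i ∈ s, n i = m ∧ p i = ofReal (v - m * a)) :
    ∀ᶠ ε : ℝ in 𝓝[>] 0, ∑ i ∈ s, p i * ofReal (a + σ * ε) ^ n i = ofReal (v + σ * m * ε) := by
  have key : ∀ i ∈ s, ∀ᶠ ε : ℝ in 𝓝[>] 0,
      ofReal (v + σ * m * ε) ≤ p i * ofReal (a + σ * ε) ^ n i := by
    intro i hi
    rcases eq_or_ne (p i) 0 with h0 | h0
    · simp [h0]
    obtain ⟨x, hx⟩ := exists_ofReal h0
    simp only [hx, ofReal_pow, ofReal_mul, ofReal_le]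
    obtain ⟨h1, h2⟩ := hle i hi x hx
    rcases h1.eq_or_lt with h | h
    · filter_upwards [self_mem_nhdsWithin] with ε hε
      have := mul_le_mul_of_nonneg_right (h2 h) (le_of_lt (Set.mem_Ioi.1 hε))
      linarith
    · have hc : Continuous fun ε : ℝ => x + n i * (a + σ * ε) - (v + σ * m * ε) := by fun_prop
      have := hc.tendsto 0
      have := this.eventually (lt_mem_nhds (a := 0) (by simp; linarith))
      filter_upwards [nhdsWithin_le_nhds this] with ε hε
      linarith
  filter_upwards [(Finset.eventually_all s).2 key] with ε hε
  obtain ⟨i, hi, rfl, hpi⟩ := hm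
  have hval : p i * ofReal (a + σ * ε) ^ n i = ofReal (v + σ * n i * ε) := by
    rw [hpi, ofReal_pow, ofReal_mul, ofReal_inj]; ring
  rw [sum_eq_apply hi, hval]
  intro j hj
  rw [hval]
  exact hε j hj

/-- If the monomials of degrees `m₁` and `m₂` attain the value of `P` at `a`, and no monomial of
smaller or larger degree does, then `a` is a root of multiplicity `m₂ - m₁`. -/
theorem isRootOfMultiplicity_of_eval {P : Rmin[X]} {ι : Type*} (s : Finset ι) (p : ι → Rmin)
    (n : ι → ℕ) (hP : ∀ y, P.eval y = ∑ i ∈ s, p i * y ^ n i) {a v : ℝ} {m₁ m₂ : ℕ}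
    (hlt : m₁ < m₂)
    (hle : ∀ i ∈ s, ∀ x, p i = ofReal x →
      v ≤ x + n i * a ∧ (v = x + n i * a → m₁ ≤ n i ∧ n i ≤ m₂))
    (h₁ : ∃ i ∈ s, n i = m₁ ∧ p i = ofReal (v - m₁ * a))
    (h₂ : ∃ i ∈ s, n i = m₂ ∧ p i = ofReal (v - m₂ * a)) :
    IsRootOfMultiplicity P (ofReal a) (m₂ - m₁) := by
  have e₀ := eventually_sum s p n (σ := 0) (fun i hi x hx => ⟨(hle i hi x hx).1, by simp⟩) h₁
  have e₁ := eventually_sum s p n (σ := 1) (fun i hi x hx => ⟨(hle i hi x hx).1, fun h => by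
    simpa using ((hle i hi x hx).2 h).1⟩) h₁
  have e₂ := eventually_sum s p n (σ := -1) (fun i hi x hx => ⟨(hle i hi x hx).1, fun h => by
    simpa using ((hle i hi x hx).2 h).2⟩) h₂
  simp only [← hP] at e₀ e₁ e₂
  have h0 : P.eval (ofReal a) = ofReal v := by simpa using e₀.exists
  have hP0 : P ≠ 0 := by
    rintro rfl
    exact ofReal_ne_zero v (by simpa using h0.symm)
  have hcount : ∀ c, IsRootMultiset P c → c.count (ofReal a) = m₂ - m₁ := by
    rintro c ⟨-, hc⟩
    obtain ⟨q, hq⟩ := exists_ofReal (Polynomial.leadingCoeff_ne_zero.2 hP0)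
    obtain ⟨w, k, hw, hev⟩ := eventually_prod a c
    obtain ⟨ε, ⟨⟨h1, h2⟩, h3, h4⟩, hε⟩ := ((e₁.and e₂).and hev |>.and self_mem_nhdsWithin).exists
    rw [hc, hw, hq, ofReal_mul, ofReal_inj] at h0
    rw [one_mul, hc, h3, hq, ofReal_mul, ofReal_inj] at h1
    rw [neg_one_mul, ← sub_eq_add_neg, hc, h4, hq, ofReal_mul, ofReal_inj] at h2
    -- The right slope of the product is `k` and its left slope is `k` plus the count of `a`; they
    -- are matched with `m₁` and `m₂`.
    have h5 : (k : ℝ) = m₁ := mul_left_cancel₀ hε.ne' (by linarith)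
    have h6 : ((k + c.count (ofReal a) : ℕ) : ℝ) = m₂ := mul_left_cancel₀ hε.ne' (by linarith)
    norm_cast at h5 h6
    omega
  obtain ⟨c, hc⟩ := exists_isRootMultiset hP0
  refine ⟨⟨c, hc, ?_⟩, hcount⟩
  rw [← Multiset.count_pos, hcount c hc]
  omega

end Multiplicity

/-! ### Circuit covers and permutations -/

section Covers

variable {V : Type*}

theorem exists_of_mem_pathArcs_iterate (f : V → V) (k : ℕ) (i : V) :
    ∀ a ∈ pathArcs (List.iterate f i k) (f^[k] i), ∃ j, a = (f^[j] i, f^[j + 1] i) := by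
  induction k generalizing i with
  | zero => simp [pathArcs]
  | succ k ih =>
    have hd : (List.iterate f (f i) k).headD (f^[k] (f i)) = f i := by cases k <;> rfl
    rw [List.iterate, Function.iterate_succ_apply, pathArcs, hd, List.forall_mem_cons]
    refine ⟨⟨0, rfl⟩, fun a ha => ?_⟩
    obtain ⟨j, rfl⟩ := ih (f i) a ha
    exact ⟨j + 1, rfl⟩

/-- The cycle of a permutation through a node, as a circuit. -/
theorem exists_cycle [Finite V] (σ : Equiv.Perm V) (i : V) :
    ∃ c : List V, i ∈ c ∧ ∀ a ∈ arcsOf c, ∃ j : ℕ, a = ((σ ^ j) i, (σ ^ (j + 1)) i) := by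
  -- A closed walk is enough, so the length is the order of `σ`, not that of the cycle through `i`.
  obtain ⟨N, hN⟩ := Nat.exists_eq_add_of_lt (orderOf_pos σ)
  have hi : σ^[N + 1] i = i := by
    rw [Equiv.Perm.iterate_eq_pow, show N + 1 = orderOf σ by omega, pow_orderOf_eq_one]; rfl
  refine ⟨List.iterate σ i (N + 1), by simp [List.iterate], fun a ha => ?_⟩
  rw [arcsOf_eq_pathArcs (a := i) rfl] at ha
  have := exists_of_mem_pathArcs_iterate σ (N + 1) i
  rw [hi] at this
  obtain ⟨j, hj⟩ := this a ha
  exact ⟨j, by rw [hj, Equiv.Perm.iterate_eq_pow, Equiv.Perm.iterate_eq_pow]⟩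

variable [DecidableEq V]

/-- `formPerm` maps a node to its successor, whereas the permanent uses the entries `A (σ i) i`,
whose arcs end at `i`; hence the inverse. -/
theorem formPerm_inv_mem_arcsOf {l : List V} (hc : l.Nodup) {v : V} (hv : v ∈ l) :
    (l.formPerm⁻¹ v, v) ∈ arcsOf l := by
  obtain ⟨k, hk, rfl⟩ := List.getElem_of_mem (List.mem_rotate.2 hv : v ∈ l.rotate 1)
  have hk' : k < l.length := by simpa using hk
  have : l.formPerm⁻¹ ((l.rotate 1)[k]) = l[k] := by
    rw [Equiv.Perm.inv_eq_iff_eq, List.formPerm_apply_getElem _ hc, List.getElem_rotate]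
  rw [this, arcsOf]
  exact List.mem_iff_getElem.2 ⟨k, by simpa using hk', by simp⟩

theorem exists_perm_of_nodup_flatten (cs : List (List V)) (h : cs.flatten.Nodup) :
    ∃ σ : Equiv.Perm V, (∀ v ∈ cs.flatten, ∃ c ∈ cs, (σ v, v) ∈ arcsOf c) ∧
      ∀ v ∉ cs.flatten, σ v = v := by
  induction cs with
  | nil => exact ⟨1, by simp, by simp⟩
  | cons c cs ih =>
    rw [List.flatten_cons, List.nodup_append'] at h
    obtain ⟨hc, hcs, hdisj⟩ := h
    obtain ⟨σ, h1, h2⟩ := ih hcs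
    have hfix : ∀ w ∉ c, c.formPerm⁻¹ w = w := fun w hw => by
      rw [Equiv.Perm.inv_eq_iff_eq, List.formPerm_apply_of_notMem hw]
    refine ⟨c.formPerm⁻¹ * σ, fun v hv => ?_, fun v hv => ?_⟩
    · rw [List.flatten_cons, List.mem_append] at hv
      rcases hv with hv | hv
      · refine ⟨c, by simp, ?_⟩
        rw [Equiv.Perm.mul_apply, h2 v fun h => hdisj hv h]
        exact formPerm_inv_mem_arcsOf hc hv
      · obtain ⟨c', hc', harc⟩ := h1 v hv
        refine ⟨c', by simp [hc'], ?_⟩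
        rwa [Equiv.Perm.mul_apply, hfix _ fun h => hdisj h
          (List.mem_flatten.2 ⟨c', hc', fst_mem_of_mem_arcsOf harc⟩)]
    · rw [List.flatten_cons, List.mem_append, not_or] at hv
      rw [Equiv.Perm.mul_apply, h2 v hv.2, hfix v hv.1]

theorem Graph.HasDisjointCircuitCover.exists_perm {G : Graph V} (h : G.HasDisjointCircuitCover) :
    ∃ σ : Equiv.Perm V, (∀ v ∈ G.nodes, (σ v, v) ∈ G.arcs) ∧ ∀ v ∉ G.nodes, σ v = v := by
  obtain ⟨cs, hcs, hnd, hcov⟩ := h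
  obtain ⟨σ, h1, h2⟩ := exists_perm_of_nodup_flatten cs hnd
  refine ⟨σ, fun v hv => ?_, fun v hv => h2 v fun hv' => hv ?_⟩
  · obtain ⟨c, hc, harc⟩ := h1 v (hcov v hv)
    exact (hcs c hc).2.2 _ harc
  · obtain ⟨c, hc, hvc⟩ := List.mem_flatten.1 hv'
    exact (hcs c hc).2.1 v hvc

end Covers

/-! ### The terms of the permanent at a critical value -/

section Permanent

variable {V : Type*} [Fintype V] [DecidableEq V] {A : Matrix V V Rmin}

/-- The coefficient of the term of `per(Y I ⊕ A)` given by the permutation `σ` and the choice of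
`Y` at the positions in `t`. -/
def permTerm (A : Matrix V V Rmin) (k : Equiv.Perm V × Finset V) : Rmin :=
  (∏ i ∈ k.2, (1 : Matrix V V Rmin) (k.1 i) i) * ∏ i ∈ k.2ᶜ, A (k.1 i) i

theorem eval_charPoly (y : Rmin) :
    (charPoly A).eval y = ∑ k, permTerm A k * y ^ k.2.card := by
  have h : ∀ i j, (((Polynomial.X : Rmin[X]) • (1 : Matrix V V Rmin[X]) +
      A.map Polynomial.C) i j).eval y = y * (1 : Matrix V V Rmin) i j + A i j := fun i j => by
    rcases eq_or_ne i j with rfl | hij <;> simp [*]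
  rw [charPoly, Matrix.permanent, Polynomial.eval_finsetSum, Fintype.sum_prod_type]
  refine Finset.sum_congr rfl fun σ _ => ?_
  simp only [Polynomial.eval_prod, h]
  rw [Finset.prod_add, Finset.powerset_univ]
  refine Finset.sum_congr rfl fun t _ => ?_
  rw [Finset.prod_mul_distrib, Finset.prod_const, permTerm, ← Finset.compl_eq_univ_sdiff]
  ring

theorem permTerm_eq {σ : Equiv.Perm V} {t : Finset V} (ht : ∀ i ∈ t, σ i = i) {w : V → ℝ}
    (hw : ∀ i ∉ t, value A (σ i) i = (w i : WithTop ℝ)) :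
    permTerm A (σ, t) = ofReal (∑ i ∈ tᶜ, w i) := by
  rw [permTerm, Finset.prod_eq_one fun i hi => by rw [ht i hi, Matrix.one_apply_eq], one_mul]
  apply Tropical.untrop_injective
  rw [untrop_prod, ofReal, Tropical.untrop_trop, WithTop.coe_sum]
  exact Finset.sum_congr rfl fun i hi => hw i (Finset.mem_compl.1 hi)

theorem exists_of_permTerm_eq {σ : Equiv.Perm V} {t : Finset V} {x : ℝ}
    (h : permTerm A (σ, t) = ofReal x) :
    (∀ i ∈ t, σ i = i) ∧ ∃ w : V → ℝ, (∀ i ∉ t, value A (σ i) i = (w i : WithTop ℝ)) ∧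
      x = ∑ i ∈ tᶜ, w i := by
  have hne : permTerm A (σ, t) ≠ 0 := h ▸ ofReal_ne_zero x
  have h1 : ∀ i ∈ t, σ i = i := by
    intro i hi
    by_contra hσ
    refine hne ?_
    refine mul_eq_zero_of_left (Finset.prod_eq_zero hi ?_) _
    exact Matrix.one_apply_ne hσ
  have h2 : ∀ i ∉ t, value A (σ i) i ≠ ⊤ := by
    intro i hi
    rw [value_ne_top_iff]
    intro h0
    refine hne ?_
    refine mul_eq_zero_of_right _ (Finset.prod_eq_zero (Finset.mem_compl.2 hi) ?_)
    exact h0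
  choose! w hw using fun i hi => WithTop.ne_top_iff_exists.1 (h2 i hi)
  refine ⟨h1, w, fun i hi => (hw i hi).symm, ?_⟩
  rw [permTerm_eq h1 fun i hi => (hw i hi).symm, ofReal_inj] at h
  exact h.symm

variable {l : ℕ} {u : V → ℝ}

theorem value_ge (hu : IsPotential (shift (value A) (level A l)) u) {i j : V} {x : ℝ}
    (hx : value A i j = (x : WithTop ℝ)) : level A l i + u i ≤ x + u j := by
  have := hu i j
  rw [shift, hx] at this
  norm_cast at this
  linarith

theorem permTerm_bound (hA : IsIrreducible A) (hl : 1 ≤ l) (hlk : l ≤ numCriticalValues A)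
    {k : Equiv.Perm V × Finset V} {x : ℝ} (hk : permTerm A k = ofReal x) :
    ∑ i, level A l i ≤ x + k.2.card * alpha A l ∧
      (∑ i, level A l i = x + k.2.card * alpha A l →
        (critUnion A l)ᶜ ⊆ k.2 ∧ k.2 ⊆ (critUnion A (l - 1))ᶜ) := by
  obtain ⟨σ, t⟩ := k
  obtain ⟨u, hu⟩ := exists_potential_level hA hl
  obtain ⟨hfix, w, hw, rfl⟩ := exists_of_permTerm_eq hk
  have hlev := level_lt_or_eq hA hl hlk
  let g : V → ℝ := fun i => if i ∈ t then alpha A l else w i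
  have hle : ∀ i ∈ (Finset.univ : Finset V), level A l (σ i) + u (σ i) ≤ g i + u i := by
    intro i _
    by_cases hi : i ∈ t
    · simp only [g, if_pos hi, hfix i hi]
      rcases hlev i with h | h <;> linarith [h.2]
    · simp only [g, if_neg hi]
      exact value_ge hu (hw i hi)
  have hg : ∑ i, g i = ∑ i ∈ tᶜ, w i + t.card * alpha A l := by
    rw [← Finset.sum_add_sum_compl t, Finset.sum_congr rfl fun i hi => if_pos hi,
      Finset.sum_congr (s₁ := tᶜ) rfl fun i hi => if_neg (Finset.mem_compl.1 hi),
      Finset.sum_const, nsmul_eq_mul, add_comm]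
  have hL : ∑ i, (level A l (σ i) + u (σ i)) = ∑ i, level A l i + ∑ i, u i := by
    rw [Equiv.sum_comp σ fun i => level A l i + u i, Finset.sum_add_distrib]
  have hR : ∑ i, (g i + u i) = ∑ i, g i + ∑ i, u i := Finset.sum_add_distrib
  refine ⟨by linarith [Finset.sum_le_sum hle], fun heq => ?_⟩
  -- Equality of the sums forces equality in each inequality.
  have hsat := (Finset.sum_eq_sum_iff_of_le hle).1 (by rw [hL, hR]; linarith)
  refine ⟨fun i hi => ?_, fun i hi => ?_⟩
  · by_contra hit
    refine Finset.mem_compl.1 hi (mem_critUnion.2 ?_)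
    have hinv : ∀ j, σ (σ⁻¹ j) = j := σ.apply_symm_apply
    -- As `t` consists of fixed points, the orbit of `i` stays outside `t`. It is followed by `σ⁻¹`
    -- because the saturated arcs go from `σ j` to `j`.
    have hstep : ∀ j ∉ t, σ⁻¹ j ∉ t := fun j hj h => hj (by
      have := hfix _ h
      rw [hinv] at this
      rwa [this])
    have hpow : ∀ j : ℕ, ((σ⁻¹) ^ j) i ∉ t := fun j => by
      induction j with
      | zero => exact hit
      | succ j ih => rw [pow_succ', Equiv.Perm.mul_apply]; exact hstep _ ih
    obtain ⟨c, hic, hc⟩ := exists_cycle σ⁻¹ i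
    refine exists_mem_critSet hA hl (circuitWeight_of_saturated (u := u) fun a ha => ?_) hic
    obtain ⟨j, rfl⟩ := hc a ha
    have hj := hpow (j + 1)
    have h1 : σ (((σ⁻¹) ^ (j + 1)) i) = ((σ⁻¹) ^ j) i := by
      rw [pow_succ', Equiv.Perm.mul_apply, hinv]
    have h2 := hsat (((σ⁻¹) ^ (j + 1)) i) (Finset.mem_univ _)
    have h3 := hw _ hj
    simp only [g, if_neg hj] at h2
    rw [h1] at h2 h3
    simp only [shift, h3]
    norm_cast
    linarith
  · have h2 := hsat i (Finset.mem_univ _)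
    simp only [g, if_pos hi, hfix i hi] at h2
    rcases hlev i with h | h
    · linarith [h.2]
    · exact Finset.mem_compl.2 h.1

/-- Only `m = l - 1` and `m = l` occur. In both cases the arcs of the cover are saturated by a
potential of order `l`, and the remaining nodes, where `Y` is chosen, have level `α_l`. -/
theorem exists_permTerm_eq (hA : IsIrreducible A) (hl : 1 ≤ l) (hlk : l ≤ numCriticalValues A)
    {m : ℕ} (hm : l - 1 ≤ m) (hml : m ≤ l) (hcover : (critGraph A m).HasDisjointCircuitCover) :
    ∃ k : Equiv.Perm V × Finset V, k.2.card = (critUnion A m)ᶜ.card ∧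
      permTerm A k = ofReal (∑ i, level A l i - (critUnion A m)ᶜ.card * alpha A l) := by
  obtain ⟨u, hu⟩ := exists_potential_level hA hl
  obtain ⟨σ, harc, hfix⟩ := hcover.exists_perm
  simp only [mem_nodes_critGraph hA] at harc hfix
  refine ⟨(σ, (critUnion A m)ᶜ), rfl, ?_⟩
  rw [permTerm_eq (w := fun i => level A l (σ i) + u (σ i) - u i)
    (fun i hi => hfix i (Finset.mem_compl.1 hi))]
  · have h := Finset.sum_add_sum_compl (critUnion A m)ᶜ
      fun i => level A l (σ i) + u (σ i) - u i
    rw [Finset.sum_sub_distrib (s := Finset.univ), Equiv.sum_comp σ fun i => level A l i + u i,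
      Finset.sum_add_distrib, add_sub_cancel_right,
      Finset.sum_congr (s₁ := (critUnion A m)ᶜ) rfl (g := fun _ => alpha A l),
      Finset.sum_const, nsmul_eq_mul] at h
    · rw [ofReal_inj]
      linarith
    · intro i hi
      rw [Finset.mem_compl] at hi
      rw [hfix i hi, add_sub_cancel_right]
      refine ((level_lt_or_eq hA hl hlk i).resolve_left fun h => hi ?_).2
      obtain ⟨r, hr, hrl, hir⟩ := mem_critUnion.1 h.1
      exact mem_critUnion.2 ⟨r, hr, hrl.trans hm, hir⟩
  · intro i hi
    rw [Finset.mem_compl, not_not] at hi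
    have h := saturated_of_mem_arcs_critGraph hA hml hu (harc i hi)
    simp only [shift] at h
    have ht : value A (σ i) i ≠ ⊤ := by
      intro ht
      simp [ht] at h
    obtain ⟨x, hx⟩ := WithTop.ne_top_iff_exists.1 ht
    rw [← hx] at h ⊢
    norm_cast at h ⊢
    linarith

end Permanent

end MinPlus

end

theorem mainTheorem5 {n : ℕ} (A : Matrix (Fin n) (Fin n) MinPlus.Rmin)
    (hA : MinPlus.IsIrreducible A) (l : ℕ) (hl : 1 ≤ l) (hlk : l ≤ MinPlus.numCriticalValues A)
    (hcover_prev : (MinPlus.critGraph A (l - 1)).HasDisjointCircuitCover)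
    (hcover : (MinPlus.critGraph A l).HasDisjointCircuitCover) :
    MinPlus.IsRootOfMultiplicity (MinPlus.charPoly A) (MinPlus.ofReal (MinPlus.alpha A l))
      (MinPlus.critSet A l).card := by
  have hcard := MinPlus.card_critUnion (A := A) hl
  have hle := Finset.card_le_univ (MinPlus.critUnion A l)
  have hpos := (MinPlus.critSet_nonempty hA hl hlk).card_pos
  have h1 := Finset.card_compl (MinPlus.critUnion A l)
  have h2 := Finset.card_compl (MinPlus.critUnion A (l - 1))
  have hsub : (MinPlus.critSet A l).card =
      (MinPlus.critUnion A (l - 1))ᶜ.card - (MinPlus.critUnion A l)ᶜ.card := by omega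
  rw [hsub]
  -- The cover of order `l` gives the smallest degree attaining the minimum, that of order `l - 1`
  -- the largest.
  obtain ⟨k₁, hk₁⟩ := MinPlus.exists_permTerm_eq hA hl hlk (Nat.sub_le l 1) le_rfl hcover
  obtain ⟨k₂, hk₂⟩ := MinPlus.exists_permTerm_eq hA hl hlk le_rfl (Nat.sub_le l 1) hcover_prev
  refine MinPlus.isRootOfMultiplicity_of_eval Finset.univ (MinPlus.permTerm A) (fun k => k.2.card)
    MinPlus.eval_charPoly (by omega) (fun k _ x hx => ?_) ⟨k₁, Finset.mem_univ _, hk₁⟩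
    ⟨k₂, Finset.mem_univ _, hk₂⟩
  obtain ⟨h, h'⟩ := MinPlus.permTerm_bound hA hl hlk hx
  exact ⟨h, fun heq => ⟨Finset.card_le_card (h' heq).1, Finset.card_le_card (h' heq).2⟩⟩
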